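/- Let $\mathcal G$ be a Hausdorff locally compact étale groupoid with unit space $\mathcal G^{(0)}$, range and source maps $r,s$, and write $\mathcal G_y=s^{-1}(y)$, $\mathcal G^y=r^{-1}(y)$, $\mathcal G^y_y=\mathcal G_y\cap\mathcal G^y$. Let $x\in\mathcal G^{(0)}$, let $\Gamma\subset\mathcal G^x_x$ be a subgroup and, for every $g\in\Gamma$, fix an open bisection $W_g\subset\mathcal G$ containing $g$ (an open set on which $r$ and $s$ are injective). For a unitary representation $\pi$ of $\mathcal G^y_y$ on a Hilbert space $H_\pi$, let $\operatorname{Ind}\pi=\operatorname{Ind}^{\mathcal G}_{\mathcal G^y_y}\pi$ be the representation of $C^*(\mathcal G)$ on the Hilbert space of functions $\xi\colon\mathcal G_y\to H_\pi$ with $\xi(gh)=\pi(h)^*\xi(g)$ for $h\in\mathcal G^y_y$ and $\sum_{g\in\mathcal G_y/\mathcal G^y_y}\|\xi(g)\|^2<\infty$, given by $((\operatorname{Ind}\pi)(f)\xi)(g)=\sum_{h\in\mathcal G^{r(g)}}f(h)\xi(h^{-1}g)$ for $f\in C_c(\mathcal G)$. For $\gamma\in\mathcal G_y$ let $\pi^\gamma$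 be the representation of $\mathcal G^{r(\gamma)}_{r(\gamma)}$ on $H_\pi$ given by $\pi^\gamma(h)=\pi(\gamma^{-1}h\gamma)$. Write $\pi\prec\rho$ (weak containment) if every vector state of $\pi$ lies in the weak$^*$ closure of the convex hull of the vector states of $\rho$, where unitary representations of a discrete group $\Lambda$ are viewed as representations of $C^*(\Lambda)$, and put $C^*_\pi(\Lambda)=C^*(\Lambda)/\ker\pi$. A nonzero unitary representation $\rho$ is amenable if the trivial representation is weakly contained in $\bar\rho\otimes\rho$. Let $\|T\|_2=\operatorname{Tr}(T^*T)^{1/2}$ be the Hilbert–Schmidt norm. Let $\pi$ be a unitary representation of $\mathcal G^x_x$ and let $\rho$ be an amenable irreducible unitary representation of $\Gamma$ such that $\rho\prec\pi|_\Gamma$. Let $Y\subset\mathcal G^{(0)}$ be a subset and, for every $y\in Y$, let $\pi_y$ be a unitary representation of $\mathcal G^y_y$. Consider the following conditions. (1) $\operatorname{Ind}^{\mathcal G}_{\mathcal G^x_x}\pi\prec\bigoplus_{y\in Y}\operatorname{Ind}^{\mathcal G}_{\mathcal G^y_y}\pi_y$. (2) For every neighbourhood $U$ of $x$ in $\mathcal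 G^{(0)}$, every finite set $F\subset\Gamma$ and every $\varepsilon>0$, there exist $y\in Y$, $\gamma\in\mathcal G_y$ and a Hilbert–Schmidt operator $T\colon H_\rho\to H_{\pi_y}$ such that $\|T\|_2=1$, $r(\gamma)\in U$ and, for every $g\in F$, either $W_g\cap\mathcal G^{r(\gamma)}_{r(\gamma)}=\emptyset$, or $W_g\cap\mathcal G^{r(\gamma)}_{r(\gamma)}=\{h\}$ for some $h$ and $\|T\rho(g)-\pi_y^\gamma(h)T\|_2<\varepsilon$. (3) There is a state $\varphi$ on $C^*_\rho(\Gamma)$ such that for every neighbourhood $U$ of $x$ in $\mathcal G^{(0)}$, every finite set $F\subset\Gamma$ and every $\varepsilon>0$, there exist $y\in Y$, $\gamma\in\mathcal G_y$ and a state $\nu$ on $C^*_{\pi_y^\gamma}(\mathcal G^{r(\gamma)}_{r(\gamma)})$ such that $r(\gamma)\in U$ and, for every $g\in F$, either $W_g\cap\mathcal G^{r(\gamma)}_{r(\gamma)}=\emptyset$, or $W_g\cap\mathcal G^{r(\gamma)}_{r(\gamma)}=\{h\}$ for some $h$ and $|\varphi(g)-\nu(h)|<\varepsilon$. Then $(1)\Rightarrow(2)\Rightarrow(3)$.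 -/

import Mathlib

open CategoryTheory Topology
open scoped CompactlySupported ENNReal NNReal

noncomputable section

/-! ## Étale groupoids

A groupoid is a small category in which every arrow is invertible. An arrow `g : z ⟶ x` has range
`r(g) = z` and source `s(g) = x`, so that `g ≫ h` is the product `gh`, defined when
`s(g) = r(h)`. Objects are identified with units; the isotropy group at `x` is `x ⟶ x`
with Mathlib's group structure `CategoryTheory.Groupoid.vertexGroup`, where `g * h = g ≫ h`. -/

/-- The set of all arrows of a groupoid with unit space `X`. -/
structure Arrows (X : Type*) [Groupoid X] where
  /-- the range -/
  r : X
  /-- the source -/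
  s : X
  /-- the arrow -/
  hom : r ⟶ s

/-- Étale groupoids: topological groupoids whose range map is a local homeomorphism. As the unit
map is continuous and is a section of `r`, the topology of `X` is the one that `X` has as the
subspace of units. -/
class EtaleGroupoid (X : Type*) [Groupoid X] [TopologicalSpace X]
    [TopologicalSpace (Arrows X)] : Prop where
  continuous_unit : Continuous fun x : X => (⟨x, x, 𝟙 x⟩ : Arrows X)
  continuous_inv : Continuous fun g : Arrows X => (⟨g.s, g.r, Groupoid.inv g.hom⟩ : Arrows X)
  continuous_mul : Continuous fun p : {p : Arrows X × Arrows X // p.1.s = p.2.r} =>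
    (⟨p.1.1.r, p.1.2.s, p.1.1.hom ≫ eqToHom p.2 ≫ p.1.2.hom⟩ : Arrows X)
  isLocalHomeomorph_r : IsLocalHomeomorph (Arrows.r : Arrows X → X)

/-- An open bisection: an open set of arrows on which both `r` and `s` are injective. -/
def IsOpenBisection {X : Type*} [Groupoid X] [TopologicalSpace (Arrows X)]
    (W : Set (Arrows X)) : Prop :=
  IsOpen W ∧ Set.InjOn Arrows.r W ∧ Set.InjOn Arrows.s W

/-- The intersection of a set of arrows with the isotropy group at `z`. -/
def isotropySlice {X : Type*} [Groupoid X] (W : Set (Arrows X)) (z : X) : Set (z ⟶ z) :=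
  {h | (⟨z, z, h⟩ : Arrows X) ∈ W}

/-! ## Weak containment -/

/-- Weak containment `π ≺ ρ`: every vector state of `π` is in the weak-star closure of the convex
hull of the vector states of `ρ`.

Here `π` and `ρ` are given on a set `A` with dense linear span in the C*-algebra that is
represented: on `A = Γ` for representations of `C*(Γ)`, and on `A = C_c(𝒢)` for representations
of `C*(𝒢)`. As states have norm one, the weak-star topology on the state space is the topology
of pointwise convergence on `A`, that is, the topology of `A → ℂ`. -/
def WeaklyContained {A H K : Type*} [NormedAddCommGroup H] [InnerProductSpace ℂ H]
    [NormedAddCommGroup K] [InnerProductSpace ℂ K]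
    (π : A → H →L[ℂ] H) (ρ : A → K →L[ℂ] K) : Prop :=
  {φ : A → ℂ | ∃ ξ : H, ‖ξ‖ = 1 ∧ φ = fun a => inner ℂ ξ (π a ξ)} ⊆
    closure (convexHull ℝ {φ : A → ℂ | ∃ η : K, ‖η‖ = 1 ∧ φ = fun a => inner ℂ η (ρ a η)})

/-- The direct sum, on the Hilbert space direct sum `lp H 2`, of representations which are
bounded uniformly for every element of `A`. -/
def directSum {A ι : Type*} {H : ι → Type*} [∀ i, NormedAddCommGroup (H i)]
    [∀ i, InnerProductSpace ℂ (H i)] (π : ∀ i, A → H i →L[ℂ] H i) (C : A → ℝ≥0)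
    (hC : ∀ a i, ‖π i a‖ ≤ C a) (a : A) : lp H 2 →L[ℂ] lp H 2 :=
  lp.mapCLM 2 (fun i => π i a) (C a).2 (hC a)

/-- The operators of a unitary representation. -/
def repOp {Γ H : Type*} [Group Γ] [NormedAddCommGroup H] [InnerProductSpace ℂ H] [CompleteSpace H]
    (π : Γ →* unitary (H →L[ℂ] H)) (g : Γ) : H →L[ℂ] H := (π g : H →L[ℂ] H)

/-- Irreducibility of a unitary representation: the space is nonzero and the only closed
invariant subspaces are the trivial ones. -/
def IsIrreducibleRep {Γ H : Type*} [Group Γ] [NormedAddCommGroup H] [InnerProductSpace ℂ H]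
    [CompleteSpace H] (π : Γ →* unitary (H →L[ℂ] H)) : Prop :=
  Nontrivial H ∧ ∀ V : Submodule ℂ H, IsClosed (V : Set H) →
    (∀ g, ∀ v ∈ V, repOp π g v ∈ V) → V = ⊥ ∨ V = ⊤

/-! ## Square summable families -/

theorem memlp_two_iff {ι : Type*} {E : ι → Type*} [∀ i, NormedAddCommGroup (E i)]
    {f : ∀ i, E i} : Memℓp f 2 ↔ ∑' i, ‖f i‖ₑ ^ 2 ≠ ∞ := by
  rw [memℓp_gen_iff (by norm_num)]
  have h : (fun i => ‖f i‖ ^ (2 : ℝ≥0∞).toReal) = fun i => ((‖f i‖₊ ^ 2 : ℝ≥0) : ℝ) := by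
    funext i; simp
  rw [h, NNReal.summable_coe, ← ENNReal.tsum_coe_ne_top_iff_summable]
  simp [enorm]

theorem lp_two_enorm_sq {ι : Type*} {E : ι → Type*} [∀ i, NormedAddCommGroup (E i)]
    (f : lp E 2) : ‖f‖ₑ ^ 2 = ∑' i, ‖f i‖ₑ ^ 2 := by
  have h1 := lp.norm_rpow_eq_tsum (p := 2) (by norm_num) f
  have h : (fun i => ‖f i‖ ^ (2 : ℝ≥0∞).toReal) = fun i => ((‖f i‖₊ ^ 2 : ℝ≥0) : ℝ) := by
    funext i; simp
  have hs := memlp_two_iff.1 (lp.memℓp f)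
  rw [h, ← NNReal.coe_tsum] at h1
  have h2 : ‖f‖₊ ^ 2 = ∑' i, ‖f i‖₊ ^ 2 := by
    apply NNReal.coe_injective
    rw [← h1]; simp
  have hs' : Summable fun i => ‖f i‖₊ ^ 2 := by
    rw [← ENNReal.tsum_coe_ne_top_iff_summable]
    simpa [enorm] using hs
  have := congrArg (fun t : ℝ≥0 => (t : ℝ≥0∞)) h2
  simpa [enorm, ENNReal.coe_tsum hs'] using this

/-! ## Hilbert–Schmidt operators -/

section HilbertSchmidt

variable {H K : Type*} [NormedAddCommGroup H] [InnerProductSpace ℂ H] [CompleteSpace H]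
  [NormedAddCommGroup K] [InnerProductSpace ℂ K] [CompleteSpace K]

variable (H) in
/-- An orthonormal basis of `H`. -/
def stdBasis : HilbertBasis (exists_hilbertBasis ℂ H).choose ℂ H :=
  (exists_hilbertBasis ℂ H).choose_spec.choose

theorem tsum_enorm_inner_sq {ι : Type*} (b : HilbertBasis ι ℂ H) (v : H) :
    ∑' i, ‖inner ℂ (b i) v‖ₑ ^ 2 = ‖v‖ₑ ^ 2 := by
  have h := lp_two_enorm_sq (b.repr v)
  have h2 : ‖b.repr v‖ₑ = ‖v‖ₑ := by
    simp [enorm, nnnorm, b.repr.norm_map]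
  rw [h2] at h
  rw [h]
  simp only [b.repr_apply_apply]

theorem tsum_enorm_adjoint_sq {ι κ : Type*} (b : HilbertBasis ι ℂ H) (c : HilbertBasis κ ℂ K)
    (T : H →L[ℂ] K) : ∑' i, ‖T (b i)‖ₑ ^ 2 = ∑' j, ‖T.adjoint (c j)‖ₑ ^ 2 := by
  simp_rw [← tsum_enorm_inner_sq c (T _), ← tsum_enorm_inner_sq b (T.adjoint _)]
  rw [ENNReal.tsum_comm]
  congr! 4 with j i
  rw [ContinuousLinearMap.adjoint_inner_right, ← inner_conj_symm]
  simp only [enorm, nnnorm, RCLike.norm_conj]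

/-- The sum `∑ ‖T eᵢ‖²` over an orthonormal basis does not depend on the basis. -/
theorem tsum_enorm_sq_eq {ι κ : Type*} (b : HilbertBasis ι ℂ H) (c : HilbertBasis κ ℂ H)
    (T : H →L[ℂ] K) : ∑' i, ‖T (b i)‖ₑ ^ 2 = ∑' j, ‖T (c j)‖ₑ ^ 2 := by
  rw [tsum_enorm_adjoint_sq b (stdBasis K), tsum_enorm_adjoint_sq c (stdBasis K)]

/-- `T` is Hilbert–Schmidt: `∑ ‖T eᵢ‖² < ∞` for an orthonormal basis `(eᵢ)`. -/
def IsHilbertSchmidt (T : H →L[ℂ] K) : Prop :=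
  Memℓp (fun i => T (stdBasis H i)) 2

theorem isHilbertSchmidt_iff {T : H →L[ℂ] K} :
    IsHilbertSchmidt T ↔ ∑' i, ‖T (stdBasis H i)‖ₑ ^ 2 ≠ ∞ := memlp_two_iff

theorem tsum_enorm_comp_left_le {ι : Type*} (b : HilbertBasis ι ℂ H) (T : H →L[ℂ] K)
    (A : K →L[ℂ] K) :
    ∑' i, ‖(A ∘L T) (b i)‖ₑ ^ 2 ≤ ‖A‖ₑ ^ 2 * ∑' i, ‖T (b i)‖ₑ ^ 2 := by
  rw [← ENNReal.tsum_mul_left]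
  refine ENNReal.tsum_le_tsum fun i => ?_
  rw [← mul_pow]
  gcongr
  exact A.le_opENorm _

theorem tsum_enorm_comp_le (T : H →L[ℂ] K) (A : K →L[ℂ] K) (B : H →L[ℂ] H) :
    ∑' i, ‖(A ∘L T ∘L B) (stdBasis H i)‖ₑ ^ 2 ≤
      (‖A‖ₑ * ‖B‖ₑ) ^ 2 * ∑' i, ‖T (stdBasis H i)‖ₑ ^ 2 := by
  refine (tsum_enorm_comp_left_le _ _ _).trans ?_
  rw [mul_pow, mul_assoc]
  gcongr
  rw [tsum_enorm_adjoint_sq _ (stdBasis K), tsum_enorm_adjoint_sq _ (stdBasis K) T,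
    ContinuousLinearMap.adjoint_comp]
  refine (tsum_enorm_comp_left_le _ _ _).trans ?_
  have : ‖B.adjoint‖ₑ = ‖B‖ₑ := by
    simp only [enorm, nnnorm, LinearIsometryEquiv.norm_map]
  rw [this]

variable (H K) in
/-- The subspace of Hilbert–Schmidt operators. -/
def hsSubmodule : Submodule ℂ (H →L[ℂ] K) where
  carrier := {T | IsHilbertSchmidt T}
  zero_mem' := by
    change Memℓp (fun i => (0 : H →L[ℂ] K) (stdBasis H i)) 2
    exact zero_memℓp
  add_mem' := fun h1 h2 => Memℓp.add h1 h2
  smul_mem' := fun c _ h => Memℓp.const_smul h c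

variable (H K) in
/-- The Hilbert space of Hilbert–Schmidt operators `H → K`, with inner product
`Tr(S* T) = ∑ ⟪S eᵢ, T eᵢ⟫` and norm `‖T‖₂ = (∑ ‖T eᵢ‖²)^(1/2)`. -/
def HilbertSchmidt : Type _ := hsSubmodule H K

instance : AddCommGroup (HilbertSchmidt H K) := inferInstanceAs (AddCommGroup (hsSubmodule H K))
instance : Module ℂ (HilbertSchmidt H K) := inferInstanceAs (Module ℂ (hsSubmodule H K))

/-- The underlying bounded operator. -/
def HilbertSchmidt.op (T : HilbertSchmidt H K) : H →L[ℂ] K := T.1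

/-- The family `(T eᵢ)`. -/
def HilbertSchmidt.toLp :
    HilbertSchmidt H K →ₗ[ℂ] lp (fun _ : (exists_hilbertBasis ℂ H).choose => K) 2 where
  toFun T := ⟨fun i => T.op (stdBasis H i), T.2⟩
  map_add' _ _ := rfl
  map_smul' _ _ := rfl

theorem HilbertSchmidt.toLp_injective :
    Function.Injective (HilbertSchmidt.toLp : HilbertSchmidt H K →ₗ[ℂ] _) := by
  intro S T h
  refine Subtype.ext ?_
  refine ContinuousLinearMap.ext_on
    (Submodule.dense_iff_topologicalClosure_eq_top.2 (stdBasis H).dense_span) ?_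
  rintro _ ⟨i, rfl⟩
  exact congrArg (fun f : lp (fun _ : (exists_hilbertBasis ℂ H).choose => K) 2 => f i) h

instance : NormedAddCommGroup (HilbertSchmidt H K) :=
  NormedAddCommGroup.induced _ _ HilbertSchmidt.toLp HilbertSchmidt.toLp_injective

instance : InnerProductSpace ℂ (HilbertSchmidt H K) :=
  InnerProductSpace.induced HilbertSchmidt.toLp

theorem HilbertSchmidt.inner_eq (S T : HilbertSchmidt H K) :
    inner ℂ S T = ∑' i, inner ℂ (S.op (stdBasis H i)) (T.op (stdBasis H i)) := rfl

theorem HilbertSchmidt.enorm_sq (T : HilbertSchmidt H K) :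
    ‖T‖ₑ ^ 2 = ∑' i, ‖T.op (stdBasis H i)‖ₑ ^ 2 := lp_two_enorm_sq (HilbertSchmidt.toLp T)

/-- The operator `A T B`. -/
def HilbertSchmidt.comp (A : K →L[ℂ] K) (T : HilbertSchmidt H K) (B : H →L[ℂ] H) :
    HilbertSchmidt H K :=
  ⟨A ∘L T.op ∘L B, isHilbertSchmidt_iff.2 <| ne_top_of_le_ne_top
    (ENNReal.mul_ne_top (ENNReal.pow_ne_top (ENNReal.mul_ne_top enorm_ne_top enorm_ne_top))
      (isHilbertSchmidt_iff.1 T.2)) (tsum_enorm_comp_le T.op A B)⟩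

theorem HilbertSchmidt.norm_comp_le (A : K →L[ℂ] K) (T : HilbertSchmidt H K) (B : H →L[ℂ] H) :
    ‖T.comp A B‖ ≤ ‖A‖ * ‖B‖ * ‖T‖ := by
  have h : ‖T.comp A B‖ₑ ^ 2 ≤ (‖A‖ₑ * ‖B‖ₑ * ‖T‖ₑ) ^ 2 := by
    rw [HilbertSchmidt.enorm_sq, mul_pow _ ‖T‖ₑ, HilbertSchmidt.enorm_sq]
    exact tsum_enorm_comp_le T.op A B
  have h2 := (ENNReal.pow_le_pow_left_iff (by norm_num)).1 h
  simp only [enorm] at h2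
  exact_mod_cast h2

/-- The representation `π̄ ⊗ ρ`, on the Hilbert space of Hilbert–Schmidt operators: `g` acts by
`T ↦ ρ(g) T π(g)*`. -/
def conjTensor {Γ : Type*} [Group Γ] (π : Γ →* unitary (H →L[ℂ] H))
    (ρ : Γ →* unitary (K →L[ℂ] K)) (g : Γ) : HilbertSchmidt H K →L[ℂ] HilbertSchmidt H K :=
  LinearMap.mkContinuous
    { toFun := fun T => T.comp (repOp ρ g) (star (repOp π g))
      map_add' := fun S T => Subtype.ext <| by
        change repOp ρ g ∘L (S.op + T.op) ∘L _ = repOp ρ g ∘L S.op ∘L _ + repOp ρ g ∘L T.op ∘L _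
        ext v; simp
      map_smul' := fun c T => Subtype.ext <| by
        change repOp ρ g ∘L (c • T.op) ∘L _ = c • (repOp ρ g ∘L T.op ∘L _)
        ext v; simp }
    (‖repOp ρ g‖ * ‖star (repOp π g)‖) (fun T => T.norm_comp_le _ _)

/-- Amenability of a unitary representation: it is nonzero and the trivial representation is
weakly contained in `π̄ ⊗ π`. -/
def IsAmenableRep {Γ : Type*} [Group Γ] (π : Γ →* unitary (H →L[ℂ] H)) : Prop :=
  Nontrivial H ∧ WeaklyContained (fun _ : Γ => ContinuousLinearMap.id ℂ ℂ) (conjTensor π π)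

end HilbertSchmidt

/-! ## States of group C*-algebras -/

section States

variable {Γ H : Type*} [Group Γ] [NormedAddCommGroup H] [InnerProductSpace ℂ H] [CompleteSpace H]

/-- The C*-algebra `C*_π(Γ) = C*(Γ) / ker π`, realized as the image of `C*(Γ)` under `π`: the
closed *-subalgebra of `B(H)` generated by the operators `π(g)`. -/
def repAlgebra (π : Γ →* unitary (H →L[ℂ] H)) : StarSubalgebra ℂ (H →L[ℂ] H) :=
  (StarAlgebra.adjoin ℂ (Set.range (repOp π))).topologicalClosure

/-- The image of a group element in `C*_π(Γ)`. -/
def repAlgebra.of (π : Γ →* unitary (H →L[ℂ] H)) (g : Γ) : repAlgebra π :=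
  ⟨repOp π g, StarSubalgebra.le_topologicalClosure _
    (StarAlgebra.subset_adjoin ℂ _ (Set.mem_range_self g))⟩

/-- States on `C*_π(Γ)`: positive linear functionals with value one at the unit. -/
structure RepState (π : Γ →* unitary (H →L[ℂ] H)) where
  toLinearMap : repAlgebra π →ₗ[ℂ] ℂ
  nonneg : ∀ a, 0 ≤ (toLinearMap (star a * a)).re ∧ (toLinearMap (star a * a)).im = 0
  map_one : toLinearMap 1 = 1

/-- The value of a state at a group element. -/
def RepState.val {π : Γ →* unitary (H →L[ℂ] H)} (φ : RepState π) (g : Γ) : ℂ :=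
  φ.toLinearMap (repAlgebra.of π g)

end States

/-! ## Induced representations -/

section Induced

variable {X : Type*} [Groupoid X]

/-- The set `𝒢_x` of arrows with source `x`. -/
abbrev SourceFiber (x : X) : Type _ := Σ z : X, (z ⟶ x)

/-- Two arrows with source `x` are equivalent if they differ by right multiplication by an element
of the isotropy group at `x`. -/
def cosetSetoid (x : X) : Setoid (SourceFiber x) where
  r a b := ∃ h : x ⟶ x, b = ⟨a.1, a.2 ≫ h⟩
  iseqv :=
    { refl := fun a => ⟨𝟙 x, by simp⟩
      symm := by
        rintro a _ ⟨h, rfl⟩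
        exact ⟨Groupoid.inv h, by simp⟩
      trans := by
        rintro a _ _ ⟨h, rfl⟩ ⟨k, rfl⟩
        exact ⟨h ≫ k, by simp⟩ }

/-- The coset space `𝒢_x / 𝒢^x_x`. -/
def Cosets (x : X) : Type _ := Quotient (cosetSetoid x)

/-- A representative of a coset. -/
def Cosets.rep {x : X} (c : Cosets x) : SourceFiber x := Quotient.out (s := cosetSetoid x) c

/-- The coset of an arrow. -/
def Cosets.mk {x : X} (a : SourceFiber x) : Cosets x := Quotient.mk (cosetSetoid x) a

theorem Cosets.mk_rep {x : X} (c : Cosets x) : Cosets.mk c.rep = c :=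
  Quotient.out_eq (s := cosetSetoid x) c

theorem Cosets.rep_mk {x : X} (a : SourceFiber x) :
    ∃ h : x ⟶ x, (Cosets.mk a).rep = ⟨a.1, a.2 ≫ h⟩ :=
  Setoid.symm' (cosetSetoid x) (Quotient.mk_out (s := cosetSetoid x) a)

theorem Cosets.rep_mk_fst {x : X} (a : SourceFiber x) : (Cosets.mk a).rep.1 = a.1 := by
  obtain ⟨h, hh⟩ := Cosets.rep_mk a
  rw [hh]

theorem Cosets.ext_rep_fst {x : X} {c d : Cosets x} (h : c.rep.1 = d.rep.1) : c = d := by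
  rw [← c.mk_rep, ← d.mk_rep]
  generalize c.rep = a at h
  generalize d.rep = b at h
  obtain ⟨z, g⟩ := a
  obtain ⟨w, k⟩ := b
  obtain rfl : z = w := h
  exact Quotient.sound (s := cosetSetoid x) ⟨Groupoid.inv g ≫ k, by simp⟩

variable {x : X} {H : Type*} [NormedAddCommGroup H] [InnerProductSpace ℂ H] [CompleteSpace H]

/-- The functions `ξ : 𝒢_x → H` such that `ξ(gh) = π(h)* ξ(g)` for all `h` in the isotropy group
and `∑ ‖ξ(g)‖² < ∞`, where one representative `g` is taken of every coset in
`𝒢_x / 𝒢^x_x`. -/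
def indSubmodule (π : (x ⟶ x) →* unitary (H →L[ℂ] H)) : Submodule ℂ (SourceFiber x → H) where
  carrier := {ξ | (∀ (z : X) (g : z ⟶ x) (h : x ⟶ x),
      ξ ⟨z, g ≫ h⟩ = star (repOp π h) (ξ ⟨z, g⟩)) ∧
    Memℓp (fun c : Cosets x => ξ c.rep) 2}
  zero_mem' := ⟨fun _ _ _ => by simp, zero_memℓp⟩
  add_mem' := fun h1 h2 => ⟨fun z g h => by simp [h1.1, h2.1], h1.2.add h2.2⟩
  smul_mem' := fun c _ h => ⟨fun z g k => by simp [h.1], h.2.const_smul c⟩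

/-- The Hilbert space of the induced representation, with inner product
`∑ ⟪ξ(g), η(g)⟫` over representatives `g` of the cosets. -/
def IndSpace (π : (x ⟶ x) →* unitary (H →L[ℂ] H)) : Type _ := indSubmodule π

instance (π : (x ⟶ x) →* unitary (H →L[ℂ] H)) : AddCommGroup (IndSpace π) :=
  inferInstanceAs (AddCommGroup (indSubmodule π))
instance (π : (x ⟶ x) →* unitary (H →L[ℂ] H)) : Module ℂ (IndSpace π) :=
  inferInstanceAs (Module ℂ (indSubmodule π))

variable {π : (x ⟶ x) →* unitary (H →L[ℂ] H)}

/-- The function `𝒢_x → H`. -/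
def IndSpace.fn (ξ : IndSpace π) : SourceFiber x → H := ξ.1

/-- The family of values at the representatives of cosets. -/
def IndSpace.toLp : IndSpace π →ₗ[ℂ] lp (fun _ : Cosets x => H) 2 where
  toFun ξ := ⟨fun c => ξ.fn c.rep, ξ.2.2⟩
  map_add' _ _ := rfl
  map_smul' _ _ := rfl

theorem IndSpace.fn_eq_rep (ξ : IndSpace π) (a : SourceFiber x) :
    ∃ h : x ⟶ x, ξ.fn (Cosets.mk a).rep = star (repOp π h) (ξ.fn a) := by
  obtain ⟨h, hh⟩ := Cosets.rep_mk a
  exact ⟨h, by rw [hh]; exact ξ.2.1 _ _ _⟩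

theorem norm_star_repOp_apply (h : x ⟶ x) (v : H) : ‖star (repOp π h) v‖ = ‖v‖ := by
  exact ContinuousLinearMap.norm_map_of_mem_unitary (Unitary.star_mem (π h).2) v

theorem IndSpace.norm_fn_rep (ξ : IndSpace π) (a : SourceFiber x) :
    ‖ξ.fn (Cosets.mk a).rep‖ = ‖ξ.fn a‖ := by
  obtain ⟨h, hh⟩ := ξ.fn_eq_rep a
  rw [hh, norm_star_repOp_apply]

theorem IndSpace.toLp_injective :
    Function.Injective (IndSpace.toLp : IndSpace π →ₗ[ℂ] _) := by
  rw [← LinearMap.ker_eq_bot, LinearMap.ker_eq_bot']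
  intro ξ h
  refine Subtype.ext (funext fun a => ?_)
  have h1 : ξ.fn (Cosets.mk a).rep = 0 :=
    congrArg (fun f : lp (fun _ : Cosets x => H) 2 => f (Cosets.mk a)) h
  have h2 := ξ.norm_fn_rep a
  rw [h1, norm_zero] at h2
  exact norm_eq_zero.1 h2.symm

instance : NormedAddCommGroup (IndSpace π) :=
  NormedAddCommGroup.induced _ _ IndSpace.toLp IndSpace.toLp_injective

instance : InnerProductSpace ℂ (IndSpace π) :=
  InnerProductSpace.induced IndSpace.toLp

theorem IndSpace.inner_eq (ξ η : IndSpace π) :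
    inner ℂ ξ η = ∑' c : Cosets x, inner ℂ (ξ.fn c.rep) (η.fn c.rep) := rfl

theorem IndSpace.enorm_sq (ξ : IndSpace π) :
    ‖ξ‖ₑ ^ 2 = ∑' c : Cosets x, ‖ξ.fn c.rep‖ₑ ^ 2 := lp_two_enorm_sq (IndSpace.toLp ξ)

/-- The function `g ↦ ∑ f(h) ξ(h⁻¹ g)`, where the sum is over the arrows `h` with `r(h) = r(g)`;
it has finitely many nonzero terms if `f` is in `C_c(𝒢)`. -/
def convFn (f : Arrows X → ℂ) (ξ : SourceFiber x → H) (g : SourceFiber x) : H :=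
  ∑ᶠ h : Σ w : X, (g.1 ⟶ w), f ⟨g.1, h.1, h.2⟩ • ξ ⟨h.1, Groupoid.inv h.2 ≫ g.2⟩

end Induced

/-! ### The induced operators are bounded -/

section Bound

theorem exists_fiber_bound {E B : Type*} [TopologicalSpace E] {p : E → B}
    (hp : ∀ e, ∃ U ∈ 𝓝 e, Set.InjOn p U) {K : Set E} (hK : IsCompact K) :
    ∃ N : ℕ, ∀ b, {e | e ∈ K ∧ p e = b}.encard ≤ N := by
  choose U hU hinj using hp
  obtain ⟨t, -, ht⟩ := hK.elim_nhds_subcover U fun e _ => hU e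
  refine ⟨t.card, fun b => ?_⟩
  have hsub : ∀ e : {e | e ∈ K ∧ p e = b}, ∃ i : t, (e : E) ∈ U i := by
    rintro ⟨e, he, -⟩
    obtain ⟨i, hi, hie⟩ := Set.mem_iUnion₂.1 (ht he)
    exact ⟨⟨i, hi⟩, hie⟩
  choose i hi using hsub
  have hinj' : Function.Injective i := by
    intro e e' h
    have h2 := hi e'
    rw [← h] at h2
    exact Subtype.ext (hinj _ (hi e) h2 (e.2.2.trans e'.2.2.symm))
  calc _ = ENat.card {e | e ∈ K ∧ p e = b} := rfl
    _ ≤ ENat.card t := ENat.card_le_card_of_injective hinj'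
    _ = t.card := by simp

variable {X : Type*} [Groupoid X] [TopologicalSpace X] [TopologicalSpace (Arrows X)]
  [EtaleGroupoid X]

theorem arrows_r_locally_injective (a : Arrows X) : ∃ U ∈ 𝓝 a, Set.InjOn Arrows.r U := by
  obtain ⟨e, ha, he⟩ := EtaleGroupoid.isLocalHomeomorph_r a
  refine ⟨e.source, e.open_source.mem_nhds ha, ?_⟩
  rw [he]
  exact e.injOn

theorem arrows_s_locally_injective (a : Arrows X) : ∃ U ∈ 𝓝 a, Set.InjOn Arrows.s U := by
  obtain ⟨U, hU, hinj⟩ := arrows_r_locally_injective (⟨a.s, a.r, Groupoid.inv a.hom⟩ : Arrows X)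
  refine ⟨_, (EtaleGroupoid.continuous_inv (X := X)).continuousAt.preimage_mem_nhds hU, ?_⟩
  rintro ⟨z, w, g⟩ hg ⟨z', w', g'⟩ hg' h
  have h1 := hinj hg hg' h
  simp only [Arrows.mk.injEq] at h1
  obtain ⟨rfl, rfl, h1⟩ := h1
  have h2 : g = g' := by
    have := congrArg Groupoid.inv (eq_of_heq h1)
    simpa using this
  rw [h2]

theorem exists_mult_bound (f : C_c(Arrows X, ℂ)) : ∃ C : ℕ × ℝ≥0,
    (∀ z, {a : Arrows X | f a ≠ 0 ∧ a.r = z}.encard ≤ C.1) ∧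
    (∀ z, {a : Arrows X | f a ≠ 0 ∧ a.s = z}.encard ≤ C.1) ∧ ∀ a, ‖f a‖₊ ≤ C.2 := by
  have hK : IsCompact (tsupport f) := f.hasCompactSupport
  obtain ⟨N, hN⟩ := exists_fiber_bound (p := Arrows.r) arrows_r_locally_injective hK
  obtain ⟨N', hN'⟩ := exists_fiber_bound (p := Arrows.s) arrows_s_locally_injective hK
  obtain ⟨M, hM⟩ := f.hasCompactSupport.exists_bound_of_continuous f.continuous
  refine ⟨(max N N', M.toNNReal), fun z => ?_, fun z => ?_, fun a => ?_⟩
  · refine (Set.encard_le_encard ?_).trans ((hN z).trans (by exact_mod_cast le_max_left _ _))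
    exact fun a ha => ⟨subset_tsupport _ ha.1, ha.2⟩
  · refine (Set.encard_le_encard ?_).trans ((hN' z).trans (by exact_mod_cast le_max_right _ _))
    exact fun a ha => ⟨subset_tsupport _ ha.1, ha.2⟩
  · exact (Real.le_toNNReal_iff_coe_le ((norm_nonneg _).trans (hM a))).2 (hM a)

/-- A bound for the number of arrows in the support of `f` with given range or source, together
with a bound for `|f|`. -/
def multBound (f : C_c(Arrows X, ℂ)) : ℕ × ℝ≥0 := (exists_mult_bound f).choose

/-- A bound for the norm of `f` in every induced representation. -/
def indBound (f : C_c(Arrows X, ℂ)) : ℝ≥0 := (multBound f).1 * (multBound f).2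

theorem range_support_encard_le (f : C_c(Arrows X, ℂ)) (z : X) :
    {h : Σ w : X, (z ⟶ w) | f ⟨z, h.1, h.2⟩ ≠ 0}.encard ≤ (multBound f).1 := by
  refine le_trans ?_ ((exists_mult_bound f).choose_spec.1 z)
  refine Set.encard_le_encard_of_injOn (f := fun h => ⟨z, h.1, h.2⟩) (fun h hh => ⟨hh, rfl⟩) ?_
  rintro ⟨w, h⟩ - ⟨w', h'⟩ - e
  simp only [Arrows.mk.injEq, true_and] at e
  obtain ⟨rfl, e⟩ := e
  rw [eq_of_heq e]

theorem range_support_finite (f : C_c(Arrows X, ℂ)) (z : X) :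
    {h : Σ w : X, (z ⟶ w) | f ⟨z, h.1, h.2⟩ ≠ 0}.Finite :=
  Set.finite_of_encard_le_coe (range_support_encard_le f z)

variable {x : X} {H : Type*} [NormedAddCommGroup H] [InnerProductSpace ℂ H]

theorem convFn_eq_sum (f : C_c(Arrows X, ℂ)) (ξ : SourceFiber x → H) (g : SourceFiber x) :
    convFn f ξ g = ∑ h ∈ (range_support_finite f g.1).toFinset,
      f ⟨g.1, h.1, h.2⟩ • ξ ⟨h.1, Groupoid.inv h.2 ≫ g.2⟩ := by
  refine finsum_eq_sum_of_support_subset _ fun h hh => ?_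
  simp only [Set.Finite.coe_toFinset, Set.mem_ofPred_eq]
  intro h0
  exact hh (by simp [h0])

theorem convFn_enorm_sq_le (f : C_c(Arrows X, ℂ)) (ξ : SourceFiber x → H) (g : SourceFiber x) :
    ‖convFn f ξ g‖ₑ ^ 2 ≤ (multBound f).1 * ((multBound f).2 : ℝ≥0∞) ^ 2 *
      ∑' h : {h : Σ w : X, (g.1 ⟶ w) | f ⟨g.1, h.1, h.2⟩ ≠ 0},
        ‖ξ ⟨h.1.1, Groupoid.inv h.1.2 ≫ g.2⟩‖ₑ ^ 2 := by
  set S := (range_support_finite f g.1).toFinset with hS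
  have hcard : (S.card : ℝ≥0) ≤ (multBound f).1 := by
    have := range_support_encard_le f g.1
    rw [(range_support_finite f g.1).encard_eq_coe_toFinset_card] at this
    exact_mod_cast this
  have h1 : ‖convFn f ξ g‖₊ ^ 2 ≤ (multBound f).1 * (multBound f).2 ^ 2 *
      ∑ h ∈ S, ‖ξ ⟨h.1, Groupoid.inv h.2 ≫ g.2⟩‖₊ ^ 2 := by
    rw [convFn_eq_sum]
    calc _ ≤ (∑ h ∈ S, (multBound f).2 * ‖ξ ⟨h.1, Groupoid.inv h.2 ≫ g.2⟩‖₊) ^ 2 := by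
          gcongr
          refine (nnnorm_sum_le _ _).trans (Finset.sum_le_sum fun h _ => ?_)
          rw [nnnorm_smul]
          gcongr
          exact (exists_mult_bound f).choose_spec.2.2 _
      _ = (multBound f).2 ^ 2 * (∑ h ∈ S, ‖ξ ⟨h.1, Groupoid.inv h.2 ≫ g.2⟩‖₊) ^ 2 := by
          rw [← Finset.mul_sum, mul_pow]
      _ ≤ (multBound f).2 ^ 2 *
            (S.card * ∑ h ∈ S, ‖ξ ⟨h.1, Groupoid.inv h.2 ≫ g.2⟩‖₊ ^ 2) := by
          gcongr
          exact sq_sum_le_card_mul_sum_sq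
      _ ≤ (multBound f).2 ^ 2 *
            ((multBound f).1 * ∑ h ∈ S, ‖ξ ⟨h.1, Groupoid.inv h.2 ≫ g.2⟩‖₊ ^ 2) := by
          gcongr
      _ = _ := by ring
  have h2 : ∑' h : {h : Σ w : X, (g.1 ⟶ w) | f ⟨g.1, h.1, h.2⟩ ≠ 0},
        ‖ξ ⟨h.1.1, Groupoid.inv h.1.2 ≫ g.2⟩‖ₑ ^ 2 =
      ∑ h ∈ S, ‖ξ ⟨h.1, Groupoid.inv h.2 ≫ g.2⟩‖ₑ ^ 2 := by
    have hset : {h : Σ w : X, (g.1 ⟶ w) | f ⟨g.1, h.1, h.2⟩ ≠ 0} = (S : Set _) := by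
      simp [hS]
    rw [hset]
    exact Finset.tsum_subtype' S fun h => ‖ξ ⟨h.1, Groupoid.inv h.2 ≫ g.2⟩‖ₑ ^ 2
  rw [h2]
  simp only [enorm]
  exact_mod_cast h1

variable [CompleteSpace H] {π : (x ⟶ x) →* unitary (H →L[ℂ] H)}

theorem tsum_convFn_le (f : C_c(Arrows X, ℂ)) (ξ : IndSpace π) :
    ∑' c : Cosets x, ‖convFn f ξ.fn c.rep‖ₑ ^ 2 ≤ (indBound f * ‖ξ‖ₑ) ^ 2 := by
  classical
  set N := (multBound f).1
  set M := (multBound f).2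
  let G : Cosets x → Arrows X → ℝ≥0∞ := fun d a =>
    {a : Arrows X | f a ≠ 0 ∧ a.s = d.rep.1}.indicator (fun _ => ‖ξ.fn d.rep‖ₑ ^ 2) a
  let I : Type _ := Σ c : Cosets x, {h : Σ w : X, (c.rep.1 ⟶ w) | f ⟨c.rep.1, h.1, h.2⟩ ≠ 0}
  let Φ : I → Cosets x × Arrows X := fun i =>
    (Cosets.mk ⟨i.2.1.1, Groupoid.inv i.2.1.2 ≫ i.1.rep.2⟩, ⟨i.1.rep.1, i.2.1.1, i.2.1.2⟩)
  have hΦ : Function.Injective Φ := by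
    rintro ⟨c, ⟨⟨w, h⟩, hh⟩⟩ ⟨c', ⟨⟨w', h'⟩, hh'⟩⟩ e
    have e2 := congrArg Prod.snd e
    simp only [Φ, Arrows.mk.injEq] at e2
    obtain ⟨e1, e2, e3⟩ := e2
    obtain rfl := Cosets.ext_rep_fst e1
    obtain rfl := e2
    obtain rfl := eq_of_heq e3
    rfl
  have hG : ∀ i : I, ‖ξ.fn ⟨i.2.1.1, Groupoid.inv i.2.1.2 ≫ i.1.rep.2⟩‖ₑ ^ 2 =
      G (Φ i).1 (Φ i).2 := by
    intro i
    have hm : (Φ i).2 ∈ {a : Arrows X | f a ≠ 0 ∧ a.s = (Φ i).1.rep.1} :=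
      ⟨i.2.2, (Cosets.rep_mk_fst
        ⟨i.2.1.1, Groupoid.inv i.2.1.2 ≫ i.1.rep.2⟩).symm⟩
    have hn := ξ.norm_fn_rep ⟨i.2.1.1, Groupoid.inv i.2.1.2 ≫ i.1.rep.2⟩
    simp only [G, Set.indicator_of_mem hm]
    simp only [Φ, enorm, nnnorm, hn]
  calc ∑' c : Cosets x, ‖convFn f ξ.fn c.rep‖ₑ ^ 2
      ≤ ∑' c : Cosets x, N * (M : ℝ≥0∞) ^ 2 *
        ∑' h : {h : Σ w : X, (c.rep.1 ⟶ w) | f ⟨c.rep.1, h.1, h.2⟩ ≠ 0},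
          ‖ξ.fn ⟨h.1.1, Groupoid.inv h.1.2 ≫ c.rep.2⟩‖ₑ ^ 2 :=
        ENNReal.tsum_le_tsum fun c => convFn_enorm_sq_le f ξ.fn c.rep
    _ = N * (M : ℝ≥0∞) ^ 2 * ∑' i : I, G (Φ i).1 (Φ i).2 := by
        rw [ENNReal.tsum_mul_left, ENNReal.tsum_sigma']
        congr! 5 with c h
        exact hG ⟨c, h⟩
    _ ≤ N * (M : ℝ≥0∞) ^ 2 * ∑' p : Cosets x × Arrows X, G p.1 p.2 := by
        gcongr
        exact ENNReal.tsum_comp_le_tsum_of_injective hΦ fun p => G p.1 p.2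
    _ = N * (M : ℝ≥0∞) ^ 2 * ∑' d, ∑' a, G d a := by rw [ENNReal.tsum_prod']
    _ ≤ N * (M : ℝ≥0∞) ^ 2 * ∑' d : Cosets x, N * ‖ξ.fn d.rep‖ₑ ^ 2 := by
        gcongr with d
        simp only [G]
        rw [← tsum_subtype, ENNReal.tsum_set_const]
        gcongr
        have := (exists_mult_bound f).choose_spec.2.1 d.rep.1
        have h3 : ((N : ℕ∞) : ℝ≥0∞) = (N : ℝ≥0∞) := by simp
        rw [← h3]
        exact ENat.toENNReal_le.2 this
    _ = (indBound f * ‖ξ‖ₑ) ^ 2 := by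
        rw [ENNReal.tsum_mul_left, ← IndSpace.enorm_sq, indBound]
        push_cast
        ring

theorem convFn_mem (f : C_c(Arrows X, ℂ)) (ξ : IndSpace π) : convFn f ξ.fn ∈ indSubmodule π := by
  refine ⟨fun z g k => ?_, memlp_two_iff.2 <| ne_top_of_le_ne_top
    (ENNReal.pow_ne_top (ENNReal.mul_ne_top ENNReal.coe_ne_top enorm_ne_top))
    (tsum_convFn_le f ξ)⟩
  rw [convFn_eq_sum, convFn_eq_sum, map_sum]
  refine Finset.sum_congr rfl fun h _ => ?_
  rw [map_smul, ← Category.assoc]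
  congr 1
  exact ξ.2.1 _ _ _

/-- The induced representation `Ind π`, given on `f` in `C_c(𝒢)` by
`(Ind π)(f) ξ (g) = ∑ f(h) ξ(h⁻¹ g)`, where the sum is over the arrows `h` with
`r(h) = r(g)`. -/
def indRep (π : (x ⟶ x) →* unitary (H →L[ℂ] H)) (f : C_c(Arrows X, ℂ)) :
    IndSpace π →L[ℂ] IndSpace π :=
  LinearMap.mkContinuous
    { toFun := fun ξ => ⟨convFn f ξ.fn, convFn_mem f ξ⟩
      map_add' := fun ξ η => Subtype.ext <| funext fun g => by
        change convFn f (ξ.fn + η.fn) g = convFn f ξ.fn g + convFn f η.fn g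
        simp [convFn_eq_sum, Finset.sum_add_distrib]
      map_smul' := fun c ξ => Subtype.ext <| funext fun g => by
        change convFn f (c • ξ.fn) g = c • convFn f ξ.fn g
        simp [convFn_eq_sum, Finset.smul_sum, smul_comm c] }
    (indBound f) fun ξ => by
      let η : IndSpace π := ⟨convFn f ξ.fn, convFn_mem f ξ⟩
      change ‖η‖ ≤ _
      have h : ‖η‖ₑ ^ 2 ≤ (indBound f * ‖ξ‖ₑ) ^ 2 := by
        rw [IndSpace.enorm_sq]
        exact tsum_convFn_le f ξ
      have h2 := (ENNReal.pow_le_pow_left_iff (by norm_num)).1 h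
      simp only [enorm] at h2
      exact_mod_cast h2

theorem indRep_norm_le (π : (x ⟶ x) →* unitary (H →L[ℂ] H)) (f : C_c(Arrows X, ℂ)) :
    ‖indRep π f‖ ≤ indBound f :=
  LinearMap.mkContinuous_norm_le _ (indBound f).2 _

theorem indRep_fn (π : (x ⟶ x) →* unitary (H →L[ℂ] H)) (f : C_c(Arrows X, ℂ)) (ξ : IndSpace π) :
    (indRep π f ξ).fn = convFn f ξ.fn := rfl

end Bound

/-! ## The conditions -/

section Conditions

variable {X : Type*} [Groupoid X]

/-- The representation `π^γ(h) = π(γ⁻¹ h γ)` of the isotropy group at `r(γ)`, where `π` is a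
representation of the isotropy group at `s(γ)`. -/
def transportRep {y z : X} {H : Type*} [NormedAddCommGroup H] [InnerProductSpace ℂ H]
    [CompleteSpace H] (π : (y ⟶ y) →* unitary (H →L[ℂ] H)) (γ : z ⟶ y) :
    (z ⟶ z) →* unitary (H →L[ℂ] H) :=
  π.comp (Groupoid.vertexGroupIsomOfMap γ).toMonoidHom

variable [TopologicalSpace X] {x : X} {Γ : Subgroup (x ⟶ x)} {L : Type*} [NormedAddCommGroup L]
  [InnerProductSpace ℂ L] [CompleteSpace L] {Y : Set X} {K : Y → Type*}
  [∀ y, NormedAddCommGroup (K y)] [∀ y, InnerProductSpace ℂ (K y)] [∀ y, CompleteSpace (K y)]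

/-- For every neighbourhood `U` of `x`, every finite set `F ⊆ Γ` and every `ε > 0` there are
`y ∈ Y`, an arrow `γ` with `s(γ) = y` and `z = r(γ) ∈ U`, and a Hilbert–Schmidt operator
`T : H_ρ → H_{π_y}` with `‖T‖₂ = 1` such that, for every `g ∈ F`, either `W_g` does not meet the
isotropy group at `z`, or it meets it in exactly one element `h` and
`‖T ρ(g) - π_y^γ(h) T‖₂ < ε`. -/
def HasApproxIntertwiners (W : Γ → Set (Arrows X)) (ρ : Γ →* unitary (L →L[ℂ] L))
    (σ : ∀ y : Y, ((y : X) ⟶ (y : X)) →* unitary (K y →L[ℂ] K y)) : Prop :=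
  ∀ U ∈ 𝓝 x, ∀ F : Finset Γ, ∀ ε : ℝ, 0 < ε →
    ∃ (y : Y) (z : X) (γ : z ⟶ (y : X)) (T : HilbertSchmidt L (K y)),
      ‖T‖ = 1 ∧ z ∈ U ∧ ∀ g ∈ F, isotropySlice (W g) z = ∅ ∨
        ∃ h : z ⟶ z, isotropySlice (W g) z = {h} ∧
          ‖T.comp 1 (repOp ρ g) - T.comp (repOp (transportRep (σ y) γ) h) 1‖ < ε

/-- There is a state `φ` on `C*_ρ(Γ)` such that for every neighbourhood `U` of `x`, every finite
set `F ⊆ Γ` and every `ε > 0` there are `y ∈ Y`, an arrow `γ` with `s(γ) = y` and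
`z = r(γ) ∈ U`, and a state `ν` on the C*-algebra `C*_{π_y^γ}` of the isotropy group at `z` such
that, for every `g ∈ F`, either `W_g` does not meet the isotropy group at `z`, or it meets it in
exactly one element `h` and `|φ(g) - ν(h)| < ε`. -/
def HasApproxStates (W : Γ → Set (Arrows X)) (ρ : Γ →* unitary (L →L[ℂ] L))
    (σ : ∀ y : Y, ((y : X) ⟶ (y : X)) →* unitary (K y →L[ℂ] K y)) : Prop :=
  ∃ φ : RepState ρ, ∀ U ∈ 𝓝 x, ∀ F : Finset Γ, ∀ ε : ℝ, 0 < ε →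
    ∃ (y : Y) (z : X) (γ : z ⟶ (y : X)) (ν : RepState (transportRep (σ y) γ)),
      z ∈ U ∧ ∀ g ∈ F, isotropySlice (W g) z = ∅ ∨
        ∃ h : z ⟶ z, isotropySlice (W g) z = {h} ∧ ‖φ.val g - ν.val h‖ < ε

end Conditions

end

/-!
Both implications are statements about Hilbert–Schmidt operators, and no property of pure states is
used: irreducibility of `ρ` only provides a cyclic vector `v`.

For the passage from weak containment to almost intertwining operators, choose for every `g ∈ Γ` a
bump function `b g` in `C_c(𝒢)`, supported in `W g` and over `U`, with `b g = 1` at `g` (`exists_bump`).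
On the vectors of `Ind π` that are supported on the isotropy group at `x`, the operator of `b g` is
`π(g)` (`indRep_delta`). Convolution products of functions supported in bisections stay in `C_c(𝒢)`
(`exists_convolution`), so words in the `b g` and their adjoints are available, and the weak
containments of `ρ` in `π|Γ` and of `Ind π` in `⨁ Ind π_y` combine to one for the words `b(p)* b(q)`
and `b(p)* b(g) b(q)`.

By amenability, some `S` of Hilbert–Schmidt norm one on the space of `ρ` satisfies
`Re ⟪S, ρ(g) S ρ(g)*⟫ ≈ 1` on a finite set. By cyclicity, `S` may be taken of the form
`∑ |ρ(aᵢ) v⟩⟨eᵢ|` with finitely supported coefficients `aᵢ`. Almost invariance is then one strict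
inequality for a linear functional (`defect`) of the vector state of `v`. A half-space containing a
state in the closed convex hull of a set of states contains an element of the set
(`WeaklyContained.exists_re_lt`), so the inequality holds for a single vector `η` of `⨁ Ind π_y`, and
`T = ∑ |b(aᵢ) η⟩⟨eᵢ|` almost intertwines `ρ(g)` and `b g` (`exists_almost_intertwiner`).

The space of `⨁ Ind π_y` is a square sum over all cosets of arrows `γ`, that is, over all `r(γ)` in the
orbits of the points `y`. Hence one coordinate `T_γ` satisfies the same inequality
(`HilbertSchmidt.exists_postcomp_lt`). In this coordinate, `b g` acts as the multiple `b g (h)` of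
`π_y^γ(h)` if `h` is the element of `W g` in the isotropy group at `r(γ)`
(`indSumCoord_indSum_of_mem`), and as zero if `r(γ)` is not in `U`. The normalized `T_γ` is the operator
looked for.

For the passage from operators to states, `T` gives the states `Tr(T a T*)` and `Tr(T* b T)`, which are
almost equal at `g` and `h` (`RepState.norm_val_sub_val_le`). A limit of the former along an
ultrafilter of witnesses `(y, γ, T)` is a state that works for all `U`, `F` and `ε` at once.
-/

noncomputable section

-- the section variables are kept uniform within each section
set_option linter.unusedSectionVars false

/-! ### Compactly supported functions on an étale groupoid -/

theorem IsOpenBisection.inter {X : Type*} [Groupoid X] [TopologicalSpace (Arrows X)]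
    {W V : Set (Arrows X)} (hW : IsOpenBisection W) (hV : IsOpen V) :
    IsOpenBisection (W ∩ V) :=
  ⟨hW.1.inter hV, hW.2.1.mono Set.inter_subset_left, hW.2.2.mono Set.inter_subset_left⟩

/-- A function with values in `[0, 1]` that is one at a given point. -/
theorem exists_bump {A : Type*} [TopologicalSpace A] [T2Space A] [LocallyCompactSpace A]
    {W : Set A} (hW : IsOpen W) {a : A} (ha : a ∈ W) :
    ∃ f : C_c(A, ℂ), tsupport f ⊆ W ∧ f a = 1 ∧
      ∀ b, ∃ t ∈ Set.Icc (0 : ℝ) 1, f b = t := by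
  obtain ⟨f, h1, h2, h3, h4⟩ := exists_continuousMap_one_of_isCompact_subset_isOpen
    (isCompact_singleton (x := a)) hW (Set.singleton_subset_iff.2 ha)
  have hs : Function.support (fun b => (f b : ℂ)) = Function.support f := by
    ext b; simp
  have ht : tsupport (fun b => (f b : ℂ)) = tsupport f := by
    rw [tsupport, hs, tsupport]
  refine ⟨⟨⟨fun b => (f b : ℂ), Complex.continuous_ofReal.comp f.continuous⟩, ?_⟩, ?_, ?_, ?_⟩
  · change IsCompact (tsupport fun b => (f b : ℂ))
    rwa [ht]
  · change tsupport (fun b => (f b : ℂ)) ⊆ W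
    rwa [ht]
  · change (f a : ℂ) = 1
    simp [h1 (Set.mem_singleton a)]
  · exact fun b => ⟨f b, h4 b, rfl⟩

section Topological

variable {X : Type*} [Groupoid X] [TopologicalSpace X] [TopologicalSpace (Arrows X)]
  [EtaleGroupoid X]

theorem continuous_arrows_r : Continuous (Arrows.r : Arrows X → X) :=
  (EtaleGroupoid.isLocalHomeomorph_r (X := X)).continuous

/-- Inversion of arrows as a homeomorphism. -/
def arrowsInv : Arrows X ≃ₜ Arrows X where
  toFun g := ⟨g.s, g.r, Groupoid.inv g.hom⟩
  invFun g := ⟨g.s, g.r, Groupoid.inv g.hom⟩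
  left_inv g := by simp
  right_inv g := by simp
  continuous_toFun := EtaleGroupoid.continuous_inv
  continuous_invFun := EtaleGroupoid.continuous_inv

theorem arrowsInv_apply (g : Arrows X) : arrowsInv g = ⟨g.s, g.r, Groupoid.inv g.hom⟩ := rfl

theorem continuous_arrows_s : Continuous (Arrows.s : Arrows X → X) :=
  continuous_arrows_r.comp (arrowsInv (X := X)).continuous

variable (X) in
/-- The unit map is a continuous injection of the unit space into the space of arrows. -/
theorem t2Space_units [T2Space (Arrows X)] : T2Space X :=
  T2Space.of_injective_continuous (f := fun x : X => (⟨x, x, 𝟙 x⟩ : Arrows X))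
    (fun _ _ h => congrArg Arrows.r h) EtaleGroupoid.continuous_unit

theorem IsOpenBisection.preimage_inv {W : Set (Arrows X)} (hW : IsOpenBisection W) :
    IsOpenBisection (arrowsInv ⁻¹' W) :=
  ⟨hW.1.preimage arrowsInv.continuous,
    fun _ ha _ hb h => arrowsInv.injective (hW.2.2 ha hb h),
    fun _ ha _ hb h => arrowsInv.injective (hW.2.1 ha hb h)⟩

/-- The involution `f*(g) = conj (f(g⁻¹))` on `C_c(𝒢)`. -/
def starFn (f : C_c(Arrows X, ℂ)) : C_c(Arrows X, ℂ) where
  toFun g := starRingEnd ℂ (f (arrowsInv g))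
  continuous_toFun := Complex.continuous_conj.comp (f.continuous.comp arrowsInv.continuous)
  hasCompactSupport' :=
    (f.hasCompactSupport.comp_homeomorph arrowsInv).comp_left (map_zero (starRingEnd ℂ))

theorem starFn_apply (f : C_c(Arrows X, ℂ)) (g : Arrows X) :
    starFn f g = starRingEnd ℂ (f (arrowsInv g)) := rfl

theorem tsupport_starFn_subset {f : C_c(Arrows X, ℂ)} {W : Set (Arrows X)}
    (hf : tsupport f ⊆ W) : tsupport (starFn f) ⊆ arrowsInv ⁻¹' W := by
  refine subset_trans ?_ (Set.preimage_mono hf)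
  refine closure_minimal (fun g hg => subset_tsupport _ fun h => hg ?_)
    ((isClosed_tsupport f).preimage arrowsInv.continuous)
  rw [starFn_apply, h, map_zero]

/-- If `f` is supported in an open bisection `W`, then the convolution product `f * f'` lies in
`C_c(𝒢)`: at an arrow `g` with `r(g) = r(h)`, `h ∈ W`, it is `f(h) f'(h⁻¹ g)`, and `h` depends
continuously on `r(g)`. -/
theorem exists_convolution [T2Space (Arrows X)] {W : Set (Arrows X)} (hW : IsOpenBisection W)
    {f : C_c(Arrows X, ℂ)} (hf : tsupport f ⊆ W) (f' : C_c(Arrows X, ℂ)) :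
    ∃ F : C_c(Arrows X, ℂ),
      (∀ {z w u : X} (h : z ⟶ w) (k : w ⟶ u), (⟨z, w, h⟩ : Arrows X) ∈ W →
        F ⟨z, u, h ≫ k⟩ = f ⟨z, w, h⟩ * f' ⟨w, u, k⟩) ∧
      ∀ g : Arrows X, g.r ∉ Arrows.r '' W → F g = 0 := by
  classical
  have := t2Space_units X
  set e : W → X := fun a => a.1.r with he
  have heo : IsOpenEmbedding e := by
    refine IsOpenEmbedding.of_continuous_injective_isOpenMap
      (continuous_arrows_r.comp continuous_subtype_val) ?_ ?_
    · exact fun a b h => Subtype.ext (hW.2.1 a.2 b.2 h)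
    · exact (EtaleGroupoid.isLocalHomeomorph_r (X := X)).isOpenMap.comp hW.1.isOpenMap_subtype_val
  -- for `g` with `r(g) ∈ r(W)`, `P g` is the arrow of `W` with the range of `g`, and `Q g = (P g)⁻¹ g`
  have hβ : ∀ z ∈ Arrows.r '' W, ∃ a : W, e a = z := by
    rintro _ ⟨a, ha, rfl⟩
    exact ⟨⟨a, ha⟩, rfl⟩
  choose β hβ using hβ
  let P : {g : Arrows X // g.r ∈ Arrows.r '' W} → Arrows X := fun g => (β g.1.r g.2).1
  have hPr : ∀ g, (P g).r = g.1.r := fun g => hβ g.1.r g.2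
  have hP : Continuous P := by
    have h1 : Continuous fun g : {g : Arrows X // g.r ∈ Arrows.r '' W} => β g.1.r g.2 := by
      rw [heo.isEmbedding.continuous_iff]
      refine (continuous_arrows_r.comp continuous_subtype_val).congr fun g => ?_
      exact (hβ g.1.r g.2).symm
    exact continuous_subtype_val.comp h1
  let Q : {g : Arrows X // g.r ∈ Arrows.r '' W} → Arrows X := fun g =>
    ⟨(P g).s, g.1.s, Groupoid.inv (P g).hom ≫ eqToHom (hPr g) ≫ g.1.hom⟩
  have hQ : Continuous Q := by
    have h1 : Continuous fun g : {g : Arrows X // g.r ∈ Arrows.r '' W} =>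
        (⟨(arrowsInv (P g), g.1), hPr g⟩ : {p : Arrows X × Arrows X // p.1.s = p.2.r}) :=
      ((arrowsInv.continuous.comp hP).prodMk continuous_subtype_val).subtype_mk _
    exact EtaleGroupoid.continuous_mul.comp h1
  let F₀ : Arrows X → ℂ := fun g =>
    if hg : g.r ∈ Arrows.r '' W then f (P ⟨g, hg⟩) * f' (Q ⟨g, hg⟩) else 0
  have hF1 : ∀ {z w u : X} (h : z ⟶ w) (k : w ⟶ u), (⟨z, w, h⟩ : Arrows X) ∈ W →
      F₀ ⟨z, u, h ≫ k⟩ = f ⟨z, w, h⟩ * f' ⟨w, u, k⟩ := by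
    intro z w u h k hh
    have hg : (⟨z, u, h ≫ k⟩ : Arrows X).r ∈ Arrows.r '' W := ⟨_, hh, rfl⟩
    have hp : P ⟨_, hg⟩ = ⟨z, w, h⟩ := hW.2.1 (β z hg).2 hh (hPr ⟨_, hg⟩)
    have hq : Q ⟨_, hg⟩ = ⟨w, u, k⟩ := by
      have : ∀ (p : Arrows X) (hp : p = ⟨z, w, h⟩) (hr : p.r = z),
          (⟨p.s, u, Groupoid.inv p.hom ≫ eqToHom hr ≫ h ≫ k⟩ : Arrows X) = ⟨w, u, k⟩ := by
        rintro p rfl hr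
        simp
      exact this _ hp _
    simp only [F₀, dif_pos hg, hp, hq]
  have hF2 : ∀ g : Arrows X, g.r ∉ Arrows.r '' W → F₀ g = 0 := fun g hg => dif_neg hg
  have hF3 : ∀ g : Arrows X, F₀ g ≠ 0 → ∃ p : {p : Arrows X × Arrows X // p.1.s = p.2.r},
      p.1.1 ∈ tsupport f ∧ p.1.2 ∈ tsupport f' ∧
        (⟨p.1.1.r, p.1.2.s, p.1.1.hom ≫ eqToHom p.2 ≫ p.1.2.hom⟩ : Arrows X) = g := by
    intro g hg
    by_cases hr : g.r ∈ Arrows.r '' W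
    · obtain ⟨⟨z, w, h⟩, hh, hz⟩ := hr
      obtain ⟨z', u, g⟩ := g
      obtain rfl : z = z' := hz
      have e1 : g = h ≫ Groupoid.inv h ≫ g := by simp
      rw [e1, hF1 _ _ hh] at hg
      refine ⟨⟨(⟨z, w, h⟩, ⟨w, u, Groupoid.inv h ≫ g⟩), rfl⟩,
        subset_tsupport _ (left_ne_zero_of_mul hg), subset_tsupport _ (right_ne_zero_of_mul hg), ?_⟩
      simp
    · exact absurd (hF2 g hr) hg
  have hcont : Continuous F₀ := by
    rw [continuous_iff_continuousAt]
    intro g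
    -- off `r⁻¹(r(W))`, use that `F₀` vanishes off the closed set `r⁻¹(r(supp f)) ⊆ r⁻¹(r(W))`
    by_cases hr : g.r ∈ Arrows.r '' W
    · have ho : IsOpen {g : Arrows X | g.r ∈ Arrows.r '' W} :=
        ((EtaleGroupoid.isLocalHomeomorph_r (X := X)).isOpenMap W hW.1).preimage
          continuous_arrows_r
      refine ContinuousOn.continuousAt (s := {g : Arrows X | g.r ∈ Arrows.r '' W}) ?_
        (ho.mem_nhds hr)
      rw [continuousOn_iff_continuous_domRestrict]
      refine ((f.continuous.comp hP).mul (f'.continuous.comp hQ)).congr fun g => ?_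
      change f (P g) * f' (Q g) = F₀ g.1
      have hg : (g : Arrows X).r ∈ Arrows.r '' W := g.2
      simp only [F₀, dif_pos hg]
    · have hc : IsClosed {g : Arrows X | g.r ∈ Arrows.r '' tsupport f} :=
        ((f.hasCompactSupport.isCompact.image continuous_arrows_r).isClosed).preimage
          continuous_arrows_r
      refine (continuousAt_const (y := (0 : ℂ))).congr ?_
      filter_upwards [hc.isOpen_compl.mem_nhds fun h => hr (Set.image_mono hf h)] with k hk
      by_contra h
      obtain ⟨p, hp, -, rfl⟩ := hF3 k (Ne.symm h)
      exact hk ⟨_, hp, rfl⟩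
  have hK : IsCompact ((fun p : {p : Arrows X × Arrows X // p.1.s = p.2.r} =>
      (⟨p.1.1.r, p.1.2.s, p.1.1.hom ≫ eqToHom p.2 ≫ p.1.2.hom⟩ : Arrows X)) ''
        (Subtype.val ⁻¹' (tsupport f ×ˢ tsupport f'))) := by
    refine IsCompact.image ?_ EtaleGroupoid.continuous_mul
    have hc : IsClosed {p : Arrows X × Arrows X | p.1.s = p.2.r} :=
      isClosed_eq (continuous_arrows_s.comp continuous_fst) (continuous_arrows_r.comp continuous_snd)
    exact hc.isClosedEmbedding_subtypeVal.isCompact_preimage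
      (f.hasCompactSupport.isCompact.prod f'.hasCompactSupport.isCompact)
  refine ⟨⟨⟨F₀, hcont⟩, HasCompactSupport.intro hK fun g hg => ?_⟩, hF1, hF2⟩
  by_contra h
  obtain ⟨p, hp, hp', rfl⟩ := hF3 g h
  exact hg ⟨p, ⟨hp, hp'⟩, rfl⟩

end Topological

/-! ### Induced representations -/

section InducedSpace

variable {X : Type*} [Groupoid X] {x : X} {H : Type*} [NormedAddCommGroup H]
  [InnerProductSpace ℂ H] [CompleteSpace H] {π : (x ⟶ x) →* unitary (H →L[ℂ] H)}

theorem star_repOp {Γ : Type*} [Group Γ] (π : Γ →* unitary (H →L[ℂ] H)) (g : Γ) :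
    star (repOp π g) = repOp π g⁻¹ := by
  rw [repOp, repOp, map_inv]
  rfl

theorem repOp_mul {Γ : Type*} [Group Γ] (π : Γ →* unitary (H →L[ℂ] H)) (g h : Γ) (v : H) :
    repOp π (g * h) v = repOp π g (repOp π h v) := by
  simp [repOp]

theorem repOp_one {Γ : Type*} [Group Γ] (π : Γ →* unitary (H →L[ℂ] H)) :
    repOp π 1 = 1 := by
  simp [repOp]

theorem inner_repOp_repOp {Γ : Type*} [Group Γ] (π : Γ →* unitary (H →L[ℂ] H)) (g : Γ) (v w : H) :
    inner ℂ (repOp π g v) (repOp π g w) = inner ℂ v w :=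
  ContinuousLinearMap.inner_map_map_of_mem_unitary (π g).2 v w

theorem inner_repOp_left {Γ : Type*} [Group Γ] (π : Γ →* unitary (H →L[ℂ] H)) (g : Γ) (v w : H) :
    inner ℂ (repOp π g v) w = inner ℂ v (repOp π g⁻¹ w) := by
  rw [← inner_repOp_repOp π g v, ← repOp_mul, mul_inv_cancel, repOp_one]
  rfl

theorem norm_repOp_le {Γ : Type*} [Group Γ] (π : Γ →* unitary (H →L[ℂ] H)) (g : Γ) :
    ‖repOp π g‖ ≤ 1 :=
  ContinuousLinearMap.opNorm_le_bound _ zero_le_one fun v => by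
    rw [one_mul]
    exact (ContinuousLinearMap.norm_map_of_mem_unitary (π g).2 v).le

theorem IndSpace.fn_comp (ξ : IndSpace π) {z : X} (g : z ⟶ x) (h : x ⟶ x) :
    ξ.fn ⟨z, g ≫ h⟩ = repOp π h⁻¹ (ξ.fn ⟨z, g⟩) := by
  rw [← star_repOp]
  exact ξ.2.1 z g h

/-- The inner product of two values depends only on the coset. -/
theorem IndSpace.inner_fn_rep (ξ η : IndSpace π) (a : SourceFiber x) :
    inner ℂ (ξ.fn (Cosets.mk a).rep) (η.fn (Cosets.mk a).rep) = inner ℂ (ξ.fn a) (η.fn a) := by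
  obtain ⟨h, hh⟩ := Cosets.rep_mk a
  rw [hh, ξ.fn_comp, η.fn_comp, inner_repOp_repOp]

theorem IndSpace.norm_toLp (ξ : IndSpace π) : ‖IndSpace.toLp ξ‖ = ‖ξ‖ := rfl

/-- A square summable family of vectors indexed by the cosets is the family of values, at the
chosen representatives, of a unique equivariant function. -/
theorem IndSpace.toLp_surjective :
    Function.Surjective (IndSpace.toLp : IndSpace π →ₗ[ℂ] lp (fun _ : Cosets x => H) 2) := by
  intro f
  choose k hk using fun a : SourceFiber x => Cosets.rep_mk a
  -- the value of the function at `a` has to be `π(k a) (f [a])`, as the chosen representative of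
  -- the coset `[a]` is `a (k a)`
  have hk' : ∀ (z : X) (g : z ⟶ x) (h : x ⟶ x), k ⟨z, g ≫ h⟩ = Groupoid.inv h ≫ k ⟨z, g⟩ := by
    intro z g h
    have h1 : Cosets.mk (⟨z, g ≫ h⟩ : SourceFiber x) = Cosets.mk ⟨z, g⟩ :=
      (Quotient.sound (s := cosetSetoid x) ⟨h, rfl⟩ : Cosets.mk ⟨z, g⟩ = _).symm
    have h2 := (hk ⟨z, g ≫ h⟩).symm.trans ((congrArg Cosets.rep h1).trans (hk ⟨z, g⟩))
    simp only [Sigma.mk.injEq, heq_eq_eq, true_and, Category.assoc, cancel_epi] at h2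
    rw [← h2]
    simp
  have hrep : ∀ c : Cosets x, k c.rep = 𝟙 x := by
    intro c
    have h1 := hk c.rep
    rw [Cosets.mk_rep] at h1
    generalize c.rep = a at h1
    obtain ⟨z, g⟩ := a
    simp only [Sigma.mk.injEq, heq_eq_eq, true_and] at h1
    exact (cancel_epi g).1 (h1.symm.trans (Category.comp_id g).symm)
  have hval : ∀ c : Cosets x, repOp π (k c.rep) (f (Cosets.mk c.rep)) = f c := by
    intro c
    rw [hrep, Cosets.mk_rep]
    change repOp π 1 (f c) = f c
    rw [repOp_one]
    rfl
  refine ⟨⟨fun a => repOp π (k a) (f (Cosets.mk a)), fun z g h => ?_, ?_⟩, ?_⟩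
  · have h1 : Cosets.mk (⟨z, g ≫ h⟩ : SourceFiber x) = Cosets.mk ⟨z, g⟩ :=
      (Quotient.sound (s := cosetSetoid x) ⟨h, rfl⟩ : Cosets.mk ⟨z, g⟩ = _).symm
    change repOp π (k ⟨z, g ≫ h⟩) (f (Cosets.mk ⟨z, g ≫ h⟩)) =
      star (repOp π h) (repOp π (k ⟨z, g⟩) (f (Cosets.mk ⟨z, g⟩)))
    rw [hk', h1, star_repOp]
    exact repOp_mul π h⁻¹ _ _
  · simp only [hval]
    exact lp.memℓp f
  · exact lp.ext (funext hval)

instance : CompleteSpace (IndSpace π) := by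
  let e : IndSpace π ≃ₗᵢ[ℂ] lp (fun _ : Cosets x => H) 2 :=
    { LinearEquiv.ofBijective IndSpace.toLp ⟨IndSpace.toLp_injective, IndSpace.toLp_surjective⟩ with
      norm_map' := fun ξ => ξ.norm_toLp }
  exact (e.toIsometryEquiv.completeSpace_iff).2 inferInstance

/-- Evaluation at an arrow is a bounded linear map. -/
def IndSpace.eval (π : (x ⟶ x) →* unitary (H →L[ℂ] H)) (a : SourceFiber x) :
    IndSpace π →L[ℂ] H :=
  LinearMap.mkContinuous
    { toFun := fun ξ => ξ.fn a
      map_add' := fun _ _ => rfl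
      map_smul' := fun _ _ => rfl } 1 fun ξ => by
    rw [one_mul, ← ξ.norm_toLp]
    change ‖ξ.fn a‖ ≤ _
    rw [← ξ.norm_fn_rep]
    exact lp.norm_apply_le_norm (by norm_num) (IndSpace.toLp ξ) (Cosets.mk a)

/-- The coset of the unit `x`. -/
def Cosets.unit (x : X) : Cosets x := Cosets.mk ⟨x, 𝟙 x⟩

theorem Cosets.ne_rep_fst {c : Cosets x} (hc : c ≠ Cosets.unit x) : x ≠ c.rep.1 :=
  fun h => hc (Cosets.ext_rep_fst (h.symm.trans (Cosets.rep_mk_fst ⟨x, 𝟙 x⟩).symm))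

open Classical in
/-- For `w` in `H`, the vector of the induced representation that is supported on the isotropy
group, with value `w` at the unit. -/
def IndSpace.delta (π : (x ⟶ x) →* unitary (H →L[ℂ] H)) (w : H) : IndSpace π :=
  ⟨fun a => if h : x = a.1 then repOp π (eqToHom h ≫ a.2)⁻¹ w else 0, by
    refine ⟨fun z g h => ?_, ?_⟩
    · by_cases hz : x = z
      · subst hz
        simp only [eqToHom_refl, Category.id_comp, dif_pos, star_repOp]
        rw [← repOp_mul, ← mul_inv_rev]
        rfl
      · simp [dif_neg hz]
    · refine memlp_two_iff.2 ?_
      rw [tsum_eq_single (Cosets.unit x)]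
      · exact ENNReal.pow_ne_top enorm_ne_top
      · intro c hc
        simp [dif_neg (Cosets.ne_rep_fst hc)]⟩

theorem IndSpace.delta_fn (w : H) (g : x ⟶ x) :
    (IndSpace.delta π w).fn ⟨x, g⟩ = repOp π g⁻¹ w := by
  refine (dif_pos rfl).trans ?_
  simp

theorem IndSpace.delta_fn_of_ne (w : H) {z : X} (hz : x ≠ z) (g : z ⟶ x) :
    (IndSpace.delta π w).fn ⟨z, g⟩ = 0 := dif_neg hz

theorem IndSpace.inner_delta (w : H) (ξ : IndSpace π) :
    inner ℂ (IndSpace.delta π w) ξ = inner ℂ w (ξ.fn ⟨x, 𝟙 x⟩) := by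
  have h1 : inner ℂ ((IndSpace.delta π w).fn ⟨x, 𝟙 x⟩) (ξ.fn ⟨x, 𝟙 x⟩) =
      inner ℂ w (ξ.fn ⟨x, 𝟙 x⟩) := by
    rw [IndSpace.delta_fn]
    change inner ℂ (repOp π (1 : x ⟶ x)⁻¹ w) _ = _
    rw [inv_one, repOp_one]
    rfl
  rw [IndSpace.inner_eq, tsum_eq_single (Cosets.unit x), Cosets.unit, IndSpace.inner_fn_rep, h1]
  intro c hc
  rw [show (IndSpace.delta π w).fn c.rep = 0 from
    IndSpace.delta_fn_of_ne w (Cosets.ne_rep_fst hc) _, inner_zero_left]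

theorem IndSpace.norm_delta (w : H) : ‖IndSpace.delta π w‖ = ‖w‖ := by
  have h : inner ℂ (IndSpace.delta π w) (IndSpace.delta π w) = inner ℂ w w := by
    rw [IndSpace.inner_delta, IndSpace.delta_fn]
    change inner ℂ w (repOp π (1 : x ⟶ x)⁻¹ w) = _
    rw [inv_one, repOp_one]
    rfl
  rw [inner_self_eq_norm_sq_to_K, inner_self_eq_norm_sq_to_K] at h
  have h2 : ‖IndSpace.delta π w‖ ^ 2 = ‖w‖ ^ 2 := by exact_mod_cast h
  exact (pow_left_inj₀ (norm_nonneg _) (norm_nonneg _) two_ne_zero).1 h2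

end InducedSpace

section InducedOperators

variable {X : Type*} [Groupoid X] {x : X} {H : Type*} [NormedAddCommGroup H]
  [InnerProductSpace ℂ H]

theorem convFn_of_mem [TopologicalSpace (Arrows X)] {W : Set (Arrows X)} (hW : IsOpenBisection W)
    {f : Arrows X → ℂ} (hf : tsupport f ⊆ W)
    (ξ : SourceFiber x → H) {z w : X} (h : z ⟶ w) (hh : (⟨z, w, h⟩ : Arrows X) ∈ W) (g : z ⟶ x) :
    convFn f ξ ⟨z, g⟩ = f ⟨z, w, h⟩ • ξ ⟨w, Groupoid.inv h ≫ g⟩ := by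
  rw [convFn, finsum_eq_single _ (⟨w, h⟩ : Σ w : X, (z ⟶ w))]
  rintro ⟨w', h'⟩ hne
  dsimp only
  rw [show f ⟨z, w', h'⟩ = 0 from ?_, zero_smul]
  by_contra h0
  have := hW.2.1 (hf (subset_tsupport _ h0)) hh rfl
  simp only [Arrows.mk.injEq, true_and] at this
  obtain ⟨rfl, h3⟩ := this
  exact hne (by rw [eq_of_heq h3])

theorem convFn_of_notMem [TopologicalSpace (Arrows X)] {W : Set (Arrows X)}
    {f : Arrows X → ℂ} (hf : tsupport f ⊆ W)
    (ξ : SourceFiber x → H) {z : X} (hz : z ∉ Arrows.r '' W) (g : z ⟶ x) :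
    convFn f ξ ⟨z, g⟩ = 0 := by
  rw [convFn]
  refine finsum_eq_zero_of_forall_eq_zero fun h => ?_
  rw [show f ⟨z, h.1, h.2⟩ = 0 from ?_, zero_smul]
  by_contra h0
  exact hz ⟨_, hf (subset_tsupport _ h0), rfl⟩

theorem exists_of_convFn_ne_zero {f : Arrows X → ℂ} {ξ : SourceFiber x → H} {a : SourceFiber x}
    (h : convFn f ξ a ≠ 0) : ∃ (w : X) (h : a.1 ⟶ w), f ⟨a.1, w, h⟩ ≠ 0 := by
  by_contra! hc
  exact h (finsum_eq_zero_of_forall_eq_zero fun h => by rw [hc, zero_smul])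

/-- The coset of `h⁻¹ g`, where `g` represents the coset `c` and `h` is the arrow of the support of
`f` with the same range; it determines `c` if `f` is supported in a bisection. -/
theorem exists_coset_shift [TopologicalSpace (Arrows X)] {W : Set (Arrows X)} (hW : IsOpenBisection W)
    {f : Arrows X → ℂ} (hf : tsupport f ⊆ W) {S : Set (Cosets x)}
    (hS : ∀ c ∈ S, ∃ (w : X) (h : c.rep.1 ⟶ w), f ⟨c.rep.1, w, h⟩ ≠ 0) :
    ∃ i : S → Cosets x, Function.Injective i ∧ ∀ c : S, ∃ (w : X) (h : c.1.rep.1 ⟶ w),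
      f ⟨c.1.rep.1, w, h⟩ ≠ 0 ∧ i c = Cosets.mk ⟨w, Groupoid.inv h ≫ c.1.rep.2⟩ := by
  choose w h hfh using fun c : S => hS c.1 c.2
  refine ⟨fun c => Cosets.mk ⟨w c, Groupoid.inv (h c) ≫ c.1.rep.2⟩, fun c d hcd => ?_,
    fun c => ⟨w c, h c, hfh c, rfl⟩⟩
  have h1 := congrArg (fun c : Cosets x => c.rep.1) hcd
  dsimp only at h1
  rw [Cosets.rep_mk_fst, Cosets.rep_mk_fst] at h1
  have h2 := hW.2.2 (hf (subset_tsupport _ (hfh c))) (hf (subset_tsupport _ (hfh d))) h1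
  exact Subtype.ext (Cosets.ext_rep_fst (congrArg Arrows.r h2))

variable [TopologicalSpace X] [TopologicalSpace (Arrows X)] [EtaleGroupoid X]

/-- Compatibility of the induced representations with the convolution product. -/
theorem convFn_convolution {W : Set (Arrows X)} (hW : IsOpenBisection W)
    {f f' F : C_c(Arrows X, ℂ)} (hf : tsupport f ⊆ W)
    (hF : ∀ {z w u : X} (h : z ⟶ w) (k : w ⟶ u), (⟨z, w, h⟩ : Arrows X) ∈ W →
        F ⟨z, u, h ≫ k⟩ = f ⟨z, w, h⟩ * f' ⟨w, u, k⟩)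
    (hF0 : ∀ g : Arrows X, g.r ∉ Arrows.r '' W → F g = 0) (ξ : SourceFiber x → H) :
    convFn F ξ = convFn f (convFn f' ξ) := by
  funext a
  obtain ⟨z, g⟩ := a
  by_cases hz : z ∈ Arrows.r '' W
  · obtain ⟨⟨z', w, h⟩, hh, hz'⟩ := hz
    obtain rfl : z' = z := hz'
    rw [convFn_of_mem hW hf _ h hh, convFn_eq_sum f']
    rw [← finsum_eq_sum_of_support_subset (fun k : Σ u : X, (w ⟶ u) =>
      f' ⟨w, k.1, k.2⟩ • ξ ⟨k.1, Groupoid.inv k.2 ≫ Groupoid.inv h ≫ g⟩)]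
    · let e : (Σ u : X, (w ⟶ u)) ≃ (Σ u : X, (z' ⟶ u)) :=
        { toFun := fun k => ⟨k.1, h ≫ k.2⟩
          invFun := fun k => ⟨k.1, Groupoid.inv h ≫ k.2⟩
          left_inv := fun k => by simp
          right_inv := fun k => by simp }
      rw [convFn, ← finsum_comp_equiv e, smul_finsum]
      refine finsum_congr fun k => ?_
      change F ⟨z', k.1, h ≫ k.2⟩ • ξ ⟨k.1, Groupoid.inv (h ≫ k.2) ≫ g⟩ = _
      rw [hF h k.2 hh, mul_smul]
      simp
    · intro k hk
      simp only [Set.Finite.coe_toFinset]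
      intro h0
      exact hk (by simp [h0])
  · rw [convFn_of_notMem hf _ hz]
    by_contra h
    obtain ⟨w, h, h0⟩ := exists_of_convFn_ne_zero h
    exact h0 (hF0 _ hz)

variable [CompleteSpace H] {π : (x ⟶ x) →* unitary (H →L[ℂ] H)}

theorem indRep_convolution {W : Set (Arrows X)} (hW : IsOpenBisection W)
    {f f' F : C_c(Arrows X, ℂ)} (hf : tsupport f ⊆ W)
    (hF : ∀ {z w u : X} (h : z ⟶ w) (k : w ⟶ u), (⟨z, w, h⟩ : Arrows X) ∈ W →
        F ⟨z, u, h ≫ k⟩ = f ⟨z, w, h⟩ * f' ⟨w, u, k⟩)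
    (hF0 : ∀ g : Arrows X, g.r ∉ Arrows.r '' W → F g = 0) (ξ : IndSpace π) :
    indRep π F ξ = indRep π f (indRep π f' ξ) :=
  Subtype.ext (convFn_convolution hW hf hF hF0 ξ.fn)

/-- A function supported in a bisection that is one at an element `k` of the isotropy group acts on
the vectors supported on the isotropy group as `π(k)`. -/
theorem indRep_delta {W : Set (Arrows X)} (hW : IsOpenBisection W)
    {f : C_c(Arrows X, ℂ)} (hf : tsupport f ⊆ W) {k : x ⟶ x} (hk : f ⟨x, x, k⟩ = 1) (w : H) :
    indRep π f (IndSpace.delta π w) = IndSpace.delta π (repOp π k w) := by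
  have hkW : (⟨x, x, k⟩ : Arrows X) ∈ W := hf (subset_tsupport _ (by simp [hk]))
  refine Subtype.ext (funext fun a => ?_)
  obtain ⟨z, g⟩ := a
  change convFn f (IndSpace.delta π w).fn ⟨z, g⟩ = (IndSpace.delta π (repOp π k w)).fn ⟨z, g⟩
  by_cases hz : x = z
  · subst hz
    rw [convFn_of_mem hW hf _ k hkW, hk, one_smul, IndSpace.delta_fn, IndSpace.delta_fn,
      ← repOp_mul]
    congr 2
    change (k⁻¹ * g)⁻¹ = g⁻¹ * k
    group
  · rw [IndSpace.delta_fn_of_ne _ hz]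
    by_cases hzW : z ∈ Arrows.r '' W
    · obtain ⟨⟨z', w', h⟩, hh, hz'⟩ := hzW
      obtain rfl : z' = z := hz'
      rw [convFn_of_mem hW hf _ h hh, IndSpace.delta_fn_of_ne, smul_zero]
      rintro rfl
      exact hz (congrArg Arrows.r (hW.2.2 hkW hh rfl))
    · exact convFn_of_notMem hf _ hzW g

theorem indRep_norm_le_of_le_one {W : Set (Arrows X)} (hW : IsOpenBisection W)
    {f : C_c(Arrows X, ℂ)} (hf : tsupport f ⊆ W) (hf1 : ∀ a, ‖f a‖ ≤ 1) (ξ : IndSpace π) :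
    ‖indRep π f ξ‖ ≤ ‖ξ‖ := by
  have h : ‖indRep π f ξ‖ₑ ^ 2 ≤ ‖ξ‖ₑ ^ 2 := by
    rw [IndSpace.enorm_sq, IndSpace.enorm_sq, ← tsum_subtype_eq_of_support_subset
      (s := {c : Cosets x | convFn f ξ.fn c.rep ≠ 0})]
    · obtain ⟨i, hi, hi'⟩ := exists_coset_shift hW hf
        (S := {c : Cosets x | convFn f ξ.fn c.rep ≠ 0}) fun c hc => exists_of_convFn_ne_zero hc
      refine le_trans (ENNReal.tsum_le_tsum fun c => ?_)
        (ENNReal.tsum_comp_le_tsum_of_injective hi fun c => ‖ξ.fn c.rep‖ₑ ^ 2)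
      gcongr
      obtain ⟨w, h, hfh, hic⟩ := hi' c
      rw [hic, indRep_fn]
      have h1 : ‖convFn f ξ.fn c.1.rep‖ ≤
          ‖ξ.fn (Cosets.mk ⟨w, Groupoid.inv h ≫ c.1.rep.2⟩).rep‖ := by
        rw [ξ.norm_fn_rep]
        refine (congrArg norm
          (convFn_of_mem hW hf ξ.fn h (hf (subset_tsupport _ hfh)) c.1.rep.2)).trans_le ?_
        rw [norm_smul]
        exact mul_le_of_le_one_left (norm_nonneg _) (hf1 _)
      simp only [enorm]
      exact_mod_cast h1
    · intro c hc h0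
      refine hc ?_
      dsimp only
      rw [indRep_fn, h0, enorm_zero, zero_pow two_ne_zero]
  have h2 := (ENNReal.pow_le_pow_left_iff (by norm_num)).1 h
  simp only [enorm] at h2
  exact_mod_cast h2

/-- The adjoint of `(Ind π)(f)` is `(Ind π)(f*)`, for `f` supported in a bisection. -/
theorem inner_indRep_left {W : Set (Arrows X)} (hW : IsOpenBisection W)
    {f : C_c(Arrows X, ℂ)} (hf : tsupport f ⊆ W) (ξ η : IndSpace π) :
    inner ℂ (indRep π (starFn f) ξ) η = inner ℂ ξ (indRep π f η) := by
  rw [IndSpace.inner_eq, IndSpace.inner_eq]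
  have hS : ∀ c ∈ Function.support fun c : Cosets x =>
      inner ℂ (ξ.fn c.rep) ((indRep π f η).fn c.rep),
      ∃ (w : X) (h : c.rep.1 ⟶ w), f ⟨c.rep.1, w, h⟩ ≠ 0 := by
    intro c hc
    refine exists_of_convFn_ne_zero (ξ := η.fn) fun h0 => hc ?_
    dsimp only
    rw [indRep_fn, h0, inner_zero_right]
  obtain ⟨i, hi, hi'⟩ := exists_coset_shift hW hf hS
  have hW' := hW.preimage_inv
  have hf' := tsupport_starFn_subset hf
  -- the two inner products agree at corresponding cosets
  have key : ∀ {z w : X} (h : z ⟶ w) (g : z ⟶ x), (⟨z, w, h⟩ : Arrows X) ∈ W →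
      inner ℂ ((indRep π (starFn f) ξ).fn ⟨w, Groupoid.inv h ≫ g⟩) (η.fn ⟨w, Groupoid.inv h ≫ g⟩) =
        inner ℂ (ξ.fn ⟨z, g⟩) ((indRep π f η).fn ⟨z, g⟩) := by
    intro z w h g hh
    have hh' : (⟨w, z, Groupoid.inv h⟩ : Arrows X) ∈ arrowsInv ⁻¹' W := by
      change (⟨z, w, Groupoid.inv (Groupoid.inv h)⟩ : Arrows X) ∈ W
      simpa using hh
    rw [indRep_fn, indRep_fn, convFn_of_mem hW hf _ h hh, convFn_of_mem hW' hf' _ _ hh',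
      starFn_apply, arrowsInv_apply, inner_smul_left, inner_smul_right]
    simp
  refine tsum_eq_tsum_of_ne_zero_bij i hi ?_ ?_
  · intro d hd
    have hne : convFn (starFn f) ξ.fn d.rep ≠ 0 := fun h0 => hd (by
      dsimp only
      rw [indRep_fn, h0, inner_zero_left])
    obtain ⟨z, k, hk⟩ := exists_of_convFn_ne_zero hne
    have hk1 : f ⟨z, d.rep.1, Groupoid.inv k⟩ ≠ 0 := fun h0 => hk (by
      rw [starFn_apply, arrowsInv_apply, h0, map_zero])
    have hkW := hf (subset_tsupport _ hk1)
    set c : Cosets x := Cosets.mk ⟨z, Groupoid.inv k ≫ d.rep.2⟩ with hc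
    have hcs : inner ℂ (ξ.fn c.rep) ((indRep π f η).fn c.rep) ≠ 0 := by
      rw [hc, IndSpace.inner_fn_rep, ← key (Groupoid.inv k) _ hkW]
      simpa using hd
    refine ⟨⟨c, hcs⟩, ?_⟩
    obtain ⟨w, h, hfh, hic⟩ := hi' ⟨c, hcs⟩
    refine Cosets.ext_rep_fst ?_
    rw [hic, Cosets.rep_mk_fst]
    exact congrArg Arrows.s (hW.2.1 (hf (subset_tsupport _ hfh)) hkW (Cosets.rep_mk_fst _))
  · intro c
    obtain ⟨w, h, hfh, hic⟩ := hi' c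
    rw [hic, IndSpace.inner_fn_rep, key h _ (hf (subset_tsupport _ hfh))]

end InducedOperators

/-! ### Weak containment -/

section Weak

variable {A B H K M : Type*} [NormedAddCommGroup H] [InnerProductSpace ℂ H]
  [NormedAddCommGroup K] [InnerProductSpace ℂ K] [NormedAddCommGroup M] [InnerProductSpace ℂ M]
  {π : A → H →L[ℂ] H} {ρ : A → K →L[ℂ] K} {τ : A → M →L[ℂ] M}

theorem WeaklyContained.trans (h1 : WeaklyContained π ρ) (h2 : WeaklyContained ρ τ) :
    WeaklyContained π τ :=
  Set.Subset.trans h1 <|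
    closure_minimal (convexHull_min h2 (convex_convexHull ℝ _).closure) isClosed_closure

theorem WeaklyContained.precomp (h : WeaklyContained π ρ) (e : B → A) :
    WeaklyContained (fun b => π (e b)) (fun b => ρ (e b)) := by
  rintro _ ⟨ξ, hξ, rfl⟩
  let P : (A → ℂ) →L[ℝ] (B → ℂ) := ContinuousLinearMap.pi fun b => ContinuousLinearMap.proj (e b)
  have h1 := image_closure_subset_closure_image P.continuous
    (Set.mem_image_of_mem P (h ⟨ξ, hξ, rfl⟩))
  have h2 := P.toLinearMap.image_convexHull {φ : A → ℂ | ∃ η : K, ‖η‖ = 1 ∧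
    φ = fun a => inner ℂ η (ρ a η)}
  change P '' _ = _ at h2
  rw [h2] at h1
  refine closure_mono (convexHull_mono ?_) h1
  rintro _ ⟨_, ⟨η, hη, rfl⟩, rfl⟩
  exact ⟨η, hη, rfl⟩

theorem weaklyContained_of_forall_exists
    (h : ∀ ξ : H, ‖ξ‖ = 1 → ∃ η : K, ‖η‖ = 1 ∧ ∀ a, inner ℂ ξ (π a ξ) = inner ℂ η (ρ a η)) :
    WeaklyContained π ρ := by
  rintro _ ⟨ξ, hξ, rfl⟩
  obtain ⟨η, hη, h⟩ := h ξ hξ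
  exact subset_closure (subset_convexHull ℝ _ ⟨η, hη, funext h⟩)

/-- An open half-space with a vector state of `π` contains a vector state of `ρ`: otherwise the
complementary closed half-space would contain the closed convex hull of the vector states of `ρ`.
So no convex combinations are needed to approximate a single linear functional. -/
theorem WeaklyContained.exists_re_lt (h : WeaklyContained π ρ) {ξ : H} (hξ : ‖ξ‖ = 1)
    (l : (A → ℂ) →L[ℂ] ℂ) {c : ℝ} (hc : (l fun a => inner ℂ ξ (π a ξ)).re < c) :
    ∃ η : K, ‖η‖ = 1 ∧ (l fun a => inner ℂ η (ρ a η)).re < c := by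
  by_contra! hn
  let l' : (A → ℂ) →L[ℝ] ℝ := Complex.reCLM.comp (l.restrictScalars ℝ)
  have h1 : closure (convexHull ℝ {φ : A → ℂ | ∃ η : K, ‖η‖ = 1 ∧
      φ = fun a => inner ℂ η (ρ a η)}) ⊆ {φ | c ≤ l' φ} := by
    refine closure_minimal (convexHull_min ?_ ?_) (isClosed_le continuous_const l'.continuous)
    · rintro _ ⟨η, hη, rfl⟩
      exact hn η hη
    · exact convex_halfSpace_ge l'.toLinearMap.isLinear c
  exact absurd (h1 (h ⟨ξ, hξ, rfl⟩)) (not_le.2 hc)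

end Weak

/-! ### Hilbert–Schmidt operators -/

section HS

variable {L V : Type*} [NormedAddCommGroup L] [InnerProductSpace ℂ L] [CompleteSpace L]
  [NormedAddCommGroup V] [InnerProductSpace ℂ V] [CompleteSpace V]

theorem HilbertSchmidt.ext_op {S T : HilbertSchmidt L V} (h : ∀ v, S.op v = T.op v) : S = T :=
  Subtype.ext (ContinuousLinearMap.ext h)

theorem HilbertSchmidt.sub_op (S T : HilbertSchmidt L V) (v : L) :
    (S - T).op v = S.op v - T.op v := rfl

theorem HilbertSchmidt.add_op (S T : HilbertSchmidt L V) (v : L) :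
    (S + T).op v = S.op v + T.op v := rfl

theorem HilbertSchmidt.smul_op (c : ℂ) (T : HilbertSchmidt L V) (v : L) :
    (c • T).op v = c • T.op v := rfl

theorem HilbertSchmidt.comp_op (A : V →L[ℂ] V) (T : HilbertSchmidt L V) (B : L →L[ℂ] L) (v : L) :
    (T.comp A B).op v = A (T.op (B v)) := rfl

theorem HilbertSchmidt.norm_comp_le_of_le_one {A : V →L[ℂ] V} {B : L →L[ℂ] L} (hA : ‖A‖ ≤ 1)
    (hB : ‖B‖ ≤ 1) (T : HilbertSchmidt L V) : ‖T.comp A B‖ ≤ ‖T‖ :=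
  (T.norm_comp_le A B).trans (mul_le_of_le_one_left (norm_nonneg _)
    (mul_le_one₀ hA (norm_nonneg _) hB))

/-- A Hilbert–Schmidt operator followed by a bounded operator. -/
def HilbertSchmidt.postcomp {V' : Type*} [NormedAddCommGroup V'] [InnerProductSpace ℂ V']
    [CompleteSpace V'] (A : V →L[ℂ] V') (T : HilbertSchmidt L V) : HilbertSchmidt L V' :=
  ⟨A ∘L T.op, isHilbertSchmidt_iff.2 <| by
    refine ne_top_of_le_ne_top (ENNReal.mul_ne_top (ENNReal.pow_ne_top (enorm_ne_top (x := A)))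
      (isHilbertSchmidt_iff.1 T.2)) (b := ‖A‖ₑ ^ 2 * _) ?_
    rw [← ENNReal.tsum_mul_left]
    refine ENNReal.tsum_le_tsum fun i => ?_
    rw [← mul_pow]
    gcongr
    exact A.le_opENorm _⟩

theorem HilbertSchmidt.postcomp_op {V' : Type*} [NormedAddCommGroup V'] [InnerProductSpace ℂ V']
    [CompleteSpace V'] (A : V →L[ℂ] V') (T : HilbertSchmidt L V) (v : L) :
    (T.postcomp A).op v = A (T.op v) := rfl

/-- If the norm of `V` is the square sum of the norms of coordinates and if a finite family `S` of
operators into `V` is small in comparison with `T`, then so it is in one of the coordinates. -/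
theorem HilbertSchmidt.exists_postcomp_lt {ι G : Type*} {V' : ι → Type*}
    [∀ i, NormedAddCommGroup (V' i)] [∀ i, InnerProductSpace ℂ (V' i)] [∀ i, CompleteSpace (V' i)]
    (A : ∀ i, V →L[ℂ] V' i) (hA : ∀ v, ‖v‖ₑ ^ 2 = ∑' i, ‖A i v‖ₑ ^ 2) (F : Finset G)
    (S : G → HilbertSchmidt L V) (T : HilbertSchmidt L V) {c : ℝ}
    (h : ∑ g ∈ F, ‖S g‖ ^ 2 < c * ‖T‖ ^ 2) :
    ∃ i, ∑ g ∈ F, ‖(S g).postcomp (A i)‖ ^ 2 < c * ‖T.postcomp (A i)‖ ^ 2 := by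
  have key : ∀ R : HilbertSchmidt L V, ‖R‖ₑ ^ 2 = ∑' i, ‖R.postcomp (A i)‖ₑ ^ 2 := by
    intro R
    simp_rw [HilbertSchmidt.enorm_sq, hA]
    exact ENNReal.tsum_comm
  have hsum : ∀ R : HilbertSchmidt L V, HasSum (fun i => ‖R.postcomp (A i)‖ ^ 2) (‖R‖ ^ 2) := by
    intro R
    have h1 := key R
    have h2 : HasSum (fun i => ‖R.postcomp (A i)‖₊ ^ 2) (‖R‖₊ ^ 2) := by
      rw [← ENNReal.hasSum_coe]
      push_cast
      simp only [enorm] at h1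
      rw [h1]
      exact ENNReal.summable.hasSum
    have h3 := NNReal.hasSum_coe.2 h2
    push_cast at h3
    exact h3
  by_contra! hc
  exact absurd (hasSum_le hc ((hsum T).mul_left c) (hasSum_sum fun g _ => hsum (S g)))
    (not_le.2 h)

/-- The finite rank operator that maps the basis vectors `eᵢ` with `i ∈ E` to `u i` and all other
ones to zero. -/
def finiteRankOp (E : Finset (exists_hilbertBasis ℂ L).choose)
    (u : (exists_hilbertBasis ℂ L).choose → V) : L →L[ℂ] V :=
  ∑ i ∈ E, (innerSL ℂ (stdBasis L i)).smulRight (u i)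

theorem finiteRankOp_apply (E : Finset (exists_hilbertBasis ℂ L).choose)
    (u : (exists_hilbertBasis ℂ L).choose → V) (v : L) :
    finiteRankOp E u v = ∑ i ∈ E, inner ℂ (stdBasis L i) v • u i := by
  simp [finiteRankOp]

open Classical in
theorem finiteRankOp_basis (E : Finset (exists_hilbertBasis ℂ L).choose)
    (u : (exists_hilbertBasis ℂ L).choose → V) (i : (exists_hilbertBasis ℂ L).choose) :
    finiteRankOp E u (stdBasis L i) = if i ∈ E then u i else 0 := by
  simp [finiteRankOp_apply, orthonormal_iff_ite.1 (stdBasis L).orthonormal]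

/-- `finiteRankOp` as an element of the space of Hilbert–Schmidt operators. -/
def HilbertSchmidt.finiteRank (E : Finset (exists_hilbertBasis ℂ L).choose)
    (u : (exists_hilbertBasis ℂ L).choose → V) : HilbertSchmidt L V :=
  ⟨finiteRankOp E u, isHilbertSchmidt_iff.2 <| by
    rw [tsum_eq_sum (s := E)]
    · exact ENNReal.sum_ne_top.2 fun i _ => ENNReal.pow_ne_top enorm_ne_top
    · intro i hi
      rw [finiteRankOp_basis, if_neg hi, enorm_zero, zero_pow two_ne_zero]⟩

theorem HilbertSchmidt.finiteRank_op (E : Finset (exists_hilbertBasis ℂ L).choose)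
    (u : (exists_hilbertBasis ℂ L).choose → V) :
    (finiteRank E u).op = finiteRankOp E u := rfl

theorem HilbertSchmidt.inner_finiteRank_comp (E : Finset (exists_hilbertBasis ℂ L).choose)
    (u : (exists_hilbertBasis ℂ L).choose → V) (A : V →L[ℂ] V) (B : L →L[ℂ] L) :
    inner ℂ (finiteRank E u) ((finiteRank E u).comp A B) =
      ∑ i ∈ E, ∑ j ∈ E, inner ℂ (stdBasis L j) (B (stdBasis L i)) * inner ℂ (u i) (A (u j)) := by
  rw [HilbertSchmidt.inner_eq, tsum_eq_sum (s := E)]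
  · refine Finset.sum_congr rfl fun i hi => ?_
    rw [comp_op, finiteRank_op, finiteRankOp_basis, if_pos hi, finiteRankOp_apply, map_sum,
      inner_sum]
    refine Finset.sum_congr rfl fun j _ => ?_
    rw [map_smul, inner_smul_right]
  · intro i hi
    rw [finiteRank_op, finiteRankOp_basis, if_neg hi, inner_zero_left]

theorem HilbertSchmidt.inner_finiteRank_self (E : Finset (exists_hilbertBasis ℂ L).choose)
    (u : (exists_hilbertBasis ℂ L).choose → V) :
    inner ℂ (finiteRank E u) (finiteRank E u) = ∑ i ∈ E, inner ℂ (u i) (u i) := by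
  rw [HilbertSchmidt.inner_eq, tsum_eq_sum (s := E)]
  · refine Finset.sum_congr rfl fun i hi => ?_
    rw [finiteRank_op, finiteRankOp_basis, if_pos hi]
  · intro i hi
    rw [finiteRank_op, finiteRankOp_basis, if_neg hi, inner_zero_left]

/-- Finite rank operators with values of the basis vectors in a given dense set are dense. -/
theorem HilbertSchmidt.exists_finiteRank_dist_lt {D : Set V} (hD : Dense D)
    (S : HilbertSchmidt L V) {ε : ℝ} (hε : 0 < ε) :
    ∃ (E : Finset (exists_hilbertBasis ℂ L).choose)
      (u : (exists_hilbertBasis ℂ L).choose → V), (∀ i, u i ∈ D) ∧ ‖S - finiteRank E u‖ < ε := by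
  classical
  have h1 := lp.hasSum_single (p := 2) (by norm_num) (HilbertSchmidt.toLp S)
  obtain ⟨E, hE⟩ := ((Metric.tendsto_nhds.1 h1) (ε / 2) (half_pos hε)).exists
  have h2 : ∀ i, ∃ w ∈ D, ‖S.op (stdBasis L i) - w‖ < ε / 2 / (E.card + 1) := fun i => by
    obtain ⟨w, hw, h⟩ := Metric.dense_iff.1 hD (S.op (stdBasis L i)) (ε / 2 / (E.card + 1))
      (by positivity)
    exact ⟨w, h, by rwa [Metric.mem_ball, dist_comm, dist_eq_norm] at hw⟩
  choose u hu hu' using h2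
  refine ⟨E, u, hu, ?_⟩
  have h3 : HilbertSchmidt.toLp (finiteRank E u) = ∑ i ∈ E, lp.single 2 i (u i) := by
    refine lp.ext (funext fun i => ?_)
    rw [lp.coeFn_sum, Finset.sum_apply]
    change finiteRankOp E u (stdBasis L i) = _
    rw [finiteRankOp_basis]
    simp [lp.single_apply, Pi.single_apply]
  change ‖HilbertSchmidt.toLp (S - finiteRank E u)‖ < ε
  rw [map_sub, h3]
  calc _ = ‖(HilbertSchmidt.toLp S - ∑ i ∈ E, lp.single 2 i (HilbertSchmidt.toLp S i)) +
        ∑ i ∈ E, lp.single 2 i (HilbertSchmidt.toLp S i - u i)‖ := by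
        congr 1
        simp only [lp.single_sub, Finset.sum_sub_distrib]
        abel
    _ ≤ ‖HilbertSchmidt.toLp S - ∑ i ∈ E, lp.single 2 i (HilbertSchmidt.toLp S i)‖ +
        ∑ i ∈ E, ‖S.op (stdBasis L i) - u i‖ := by
        refine (norm_add_le _ _).trans (add_le_add_right ((norm_sum_le _ _).trans ?_) _)
        refine Finset.sum_le_sum fun i _ => ?_
        rw [lp.norm_single (by norm_num)]
        rfl
    _ < ε / 2 + ε / 2 := by
        refine add_lt_add_of_lt_of_le (by rwa [dist_comm, dist_eq_norm] at hE) ?_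
        calc _ ≤ ∑ i ∈ E, ε / 2 / (E.card + 1) := Finset.sum_le_sum fun i _ => (hu' i).le
          _ = E.card / (E.card + 1) * (ε / 2) := by
            rw [Finset.sum_const, nsmul_eq_mul]; ring
          _ ≤ 1 * (ε / 2) := by
            gcongr
            exact (div_le_one (by positivity)).2 (by linarith)
          _ = ε / 2 := one_mul _
    _ = ε := add_halves ε

/-- The map `T ↦ A T B` on Hilbert–Schmidt operators. -/
def HilbertSchmidt.compCLM (A : V →L[ℂ] V) (B : L →L[ℂ] L) :
    HilbertSchmidt L V →L[ℂ] HilbertSchmidt L V :=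
  LinearMap.mkContinuous
    { toFun := fun T => T.comp A B
      map_add' := fun S T => ext_op fun v => by simp only [comp_op, add_op, map_add]
      map_smul' := fun c T => ext_op fun v => by
        simp only [comp_op, smul_op, map_smul, RingHom.id_apply] }
    (‖A‖ * ‖B‖) (fun T => T.norm_comp_le _ _)

/-- The adjoint of a Hilbert–Schmidt operator. -/
def HilbertSchmidt.adjoint (T : HilbertSchmidt L V) : HilbertSchmidt V L :=
  ⟨T.op.adjoint, isHilbertSchmidt_iff.2 <| by
    rw [← tsum_enorm_adjoint_sq (stdBasis L)]
    exact isHilbertSchmidt_iff.1 T.2⟩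

theorem HilbertSchmidt.norm_adjoint (T : HilbertSchmidt L V) : ‖T.adjoint‖ = ‖T‖ := by
  have h : ‖T.adjoint‖ₑ ^ 2 = ‖T‖ₑ ^ 2 := by
    rw [enorm_sq, enorm_sq, tsum_enorm_adjoint_sq (stdBasis L) (stdBasis V) T.op]
    rfl
  have h2 := (ENNReal.pow_right_strictMono two_ne_zero).injective h
  exact congrArg NNReal.toReal (ENNReal.coe_injective h2)

theorem HilbertSchmidt.adjoint_add (S T : HilbertSchmidt L V) :
    (S + T).adjoint = S.adjoint + T.adjoint :=
  Subtype.ext (map_add (ContinuousLinearMap.adjoint (𝕜 := ℂ) (E := L) (F := V)) S.op T.op)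

theorem HilbertSchmidt.adjoint_smul (c : ℂ) (T : HilbertSchmidt L V) :
    (c • T).adjoint = starRingEnd ℂ c • T.adjoint :=
  Subtype.ext (map_smulₛₗ (ContinuousLinearMap.adjoint (𝕜 := ℂ) (E := L) (F := V)) c T.op)

theorem HilbertSchmidt.adjoint_sub (S T : HilbertSchmidt L V) :
    (S - T).adjoint = S.adjoint - T.adjoint :=
  Subtype.ext (map_sub (ContinuousLinearMap.adjoint (𝕜 := ℂ) (E := L) (F := V)) S.op T.op)

/-- The trace property `Tr(S T*) = Tr(T* S)`, by polarization from `‖T*‖₂ = ‖T‖₂`. -/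
theorem HilbertSchmidt.inner_adjoint (S T : HilbertSchmidt L V) :
    inner ℂ S.adjoint T.adjoint = inner ℂ T S := by
  rw [inner_eq_sum_norm_sq_div_four S.adjoint, inner_eq_sum_norm_sq_div_four T]
  have h1 : S.adjoint - (RCLike.I : ℂ) • T.adjoint = (S + (RCLike.I : ℂ) • T).adjoint := by
    rw [adjoint_add, adjoint_smul, RCLike.conj_I, neg_smul, sub_eq_add_neg]
  have h2 : S.adjoint + (RCLike.I : ℂ) • T.adjoint = (S - (RCLike.I : ℂ) • T).adjoint := by
    rw [adjoint_sub, adjoint_smul, RCLike.conj_I, neg_smul, sub_neg_eq_add]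
  have hI : ‖(RCLike.I : ℂ)‖ = 1 := by simp
  have h3 : ‖T - (RCLike.I : ℂ) • S‖ = ‖S + (RCLike.I : ℂ) • T‖ := by
    rw [← one_mul ‖T - _‖, ← hI, ← norm_smul, smul_sub, smul_smul]
    simp [add_comm]
  have h4 : ‖T + (RCLike.I : ℂ) • S‖ = ‖S - (RCLike.I : ℂ) • T‖ := by
    rw [← one_mul ‖T + _‖, ← hI, ← norm_smul, smul_add, smul_smul, norm_sub_rev]
    simp [sub_eq_add_neg]
  rw [h1, h2, ← adjoint_add, ← adjoint_sub, norm_adjoint, norm_adjoint, norm_adjoint, norm_adjoint,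
    h3, h4, add_comm T S, norm_sub_rev T S]

end HS

/-! ### From almost intertwining operators to states -/

section States

variable {L : Type*} [NormedAddCommGroup L] [InnerProductSpace ℂ L] [CompleteSpace L]
  {V : Type*} [NormedAddCommGroup V] [InnerProductSpace ℂ V] [CompleteSpace V]

theorem HilbertSchmidt.inner_comp_left (S T : HilbertSchmidt L V) (A : V →L[ℂ] V) :
    inner ℂ (S.comp A 1) T = inner ℂ S (T.comp (star A) 1) := by
  rw [inner_eq, inner_eq]
  refine tsum_congr fun i => ?_
  rw [comp_op, comp_op, ContinuousLinearMap.star_eq_adjoint,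
    ContinuousLinearMap.adjoint_inner_right]
  rfl

theorem HilbertSchmidt.inner_comp_star_mul_self (T : HilbertSchmidt L V) (A : V →L[ℂ] V) :
    inner ℂ T (T.comp (star A * A) 1) = inner ℂ (T.comp A 1) (T.comp A 1) := by
  rw [inner_comp_left]
  exact congrArg (inner ℂ T) (ext_op fun _ => rfl)

/-- The state `a ↦ ⟪T, a T⟫ = Tr(T* a T)` of the C*-algebra of a representation, for a Hilbert–Schmidt
operator `T` of norm one with values in the space of the representation. -/
def RepState.ofHilbertSchmidt {Γ : Type*} [Group Γ] (π : Γ →* unitary (V →L[ℂ] V))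
    (T : HilbertSchmidt L V) (hT : ‖T‖ = 1) : RepState π where
  toLinearMap :=
    { toFun := fun a => inner ℂ T (T.comp (a : V →L[ℂ] V) 1)
      map_add' := fun a b => by
        rw [← inner_add_right]
        rfl
      map_smul' := fun c a => by
        rw [RingHom.id_apply, smul_eq_mul, ← inner_smul_right]
        rfl }
  nonneg := fun a => by
    change 0 ≤ (inner ℂ T (T.comp (star (a : V →L[ℂ] V) * (a : V →L[ℂ] V)) 1)).re ∧
      (inner ℂ T (T.comp (star (a : V →L[ℂ] V) * (a : V →L[ℂ] V)) 1)).im = 0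
    rw [HilbertSchmidt.inner_comp_star_mul_self]
    exact ⟨inner_self_nonneg (𝕜 := ℂ), inner_self_im (𝕜 := ℂ) _⟩
  map_one := by
    change inner ℂ T T = (1 : ℂ)
    exact (inner_self_eq_norm_sq_to_K (𝕜 := ℂ) T).trans (by rw [hT]; norm_num)

theorem RepState.val_ofHilbertSchmidt {Γ : Type*} [Group Γ] (π : Γ →* unitary (V →L[ℂ] V))
    (T : HilbertSchmidt L V) (hT : ‖T‖ = 1) (g : Γ) :
    (RepState.ofHilbertSchmidt π T hT).val g = inner ℂ T (T.comp (repOp π g) 1) := rfl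

theorem RepState.norm_ofHilbertSchmidt_le {Γ : Type*} [Group Γ] (π : Γ →* unitary (V →L[ℂ] V))
    (T : HilbertSchmidt L V) (hT : ‖T‖ = 1) (a : repAlgebra π) :
    ‖(RepState.ofHilbertSchmidt π T hT).toLinearMap a‖ ≤ ‖(a : V →L[ℂ] V)‖ := by
  change ‖inner ℂ T (T.comp (a : V →L[ℂ] V) 1)‖ ≤ _
  refine (norm_inner_le_norm _ _).trans ?_
  rw [hT, one_mul]
  refine (T.norm_comp_le _ _).trans ?_
  rw [hT, mul_one]
  exact mul_le_of_le_one_right (norm_nonneg _) ContinuousLinearMap.norm_id_le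

/-- Along an ultrafilter, uniformly bounded states converge to a state. -/
theorem RepState.exists_tendsto {Γ : Type*} [Group Γ] {π : Γ →* unitary (V →L[ℂ] V)} {ι : Type*}
    (l : Ultrafilter ι) (φ : ι → RepState π)
    (hφ : ∀ i a, ‖(φ i).toLinearMap a‖ ≤ ‖(a : V →L[ℂ] V)‖) :
    ∃ ψ : RepState π, ∀ a, Filter.Tendsto (fun i => (φ i).toLinearMap a) l (𝓝 (ψ.toLinearMap a)) := by
  have h : ∀ a : repAlgebra π, ∃ z : ℂ, Filter.Tendsto (fun i => (φ i).toLinearMap a) l (𝓝 z) := by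
    intro a
    obtain ⟨z, -, hz⟩ := (isCompact_closedBall (0 : ℂ) ‖(a : V →L[ℂ] V)‖).ultrafilter_le_nhds
      (l.map fun i => (φ i).toLinearMap a) (by
        rw [Filter.le_principal_iff]
        refine Filter.mem_map.2 (Filter.univ_mem' fun i => ?_)
        simpa using hφ i a)
    exact ⟨z, hz⟩
  choose ψ hψ using h
  refine ⟨⟨⟨⟨ψ, fun a b => ?_⟩, fun c a => ?_⟩, fun a => ⟨?_, ?_⟩, ?_⟩, hψ⟩
  · refine tendsto_nhds_unique (hψ (a + b)) ?_
    simpa using (hψ a).add (hψ b)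
  · refine tendsto_nhds_unique (hψ (c • a)) ?_
    simpa using (hψ a).const_mul c
  · exact ge_of_tendsto' ((Complex.continuous_re.tendsto _).comp (hψ (star a * a)))
      fun i => ((φ i).nonneg a).1
  · refine tendsto_nhds_unique ((Complex.continuous_im.tendsto _).comp (hψ (star a * a))) ?_
    refine tendsto_const_nhds.congr fun i => ?_
    exact ((φ i).nonneg a).2.symm
  · refine tendsto_nhds_unique (hψ 1) ?_
    refine tendsto_const_nhds.congr fun i => ?_
    exact (φ i).map_one.symm

/-- If `T` almost intertwines `ρ(g)` and `σ(h)`, then the states `Tr(T · T*)` and `Tr(T* · T)` are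
almost equal at `g` and `h`. -/
theorem RepState.norm_val_sub_val_le {Γ Λ : Type*} [Group Γ] [Group Λ]
    (ρ : Γ →* unitary (L →L[ℂ] L)) (σ : Λ →* unitary (V →L[ℂ] V)) (T : HilbertSchmidt L V)
    (hT : ‖T‖ = 1) (hT' : ‖T.adjoint‖ = 1) (g : Γ) (h : Λ) :
    ‖(ofHilbertSchmidt ρ T.adjoint hT').val g - (ofHilbertSchmidt σ T hT).val h‖ ≤
      ‖T.comp 1 (repOp ρ g) - T.comp (repOp σ h) 1‖ := by
  have h1 : T.adjoint.comp (repOp ρ g) 1 = (T.comp 1 (star (repOp ρ g))).adjoint := by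
    refine Subtype.ext ?_
    change repOp ρ g ∘L T.op.adjoint ∘L 1 =
      ContinuousLinearMap.adjoint (1 ∘L T.op ∘L star (repOp ρ g))
    rw [ContinuousLinearMap.adjoint_comp, ContinuousLinearMap.adjoint_comp,
      ← ContinuousLinearMap.star_eq_adjoint (star _), star_star]
    ext v
    simp [← ContinuousLinearMap.star_eq_adjoint]
  have h2 : star (repOp σ h) = repOp σ h⁻¹ := star_repOp σ h
  have h3 : inner ℂ T (T.comp (repOp σ h) 1) = inner ℂ (T.comp (star (repOp σ h)) 1) T := by
    rw [HilbertSchmidt.inner_comp_left, star_star]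
  rw [val_ofHilbertSchmidt, val_ofHilbertSchmidt, h1, HilbertSchmidt.inner_adjoint, h3,
    ← inner_sub_left]
  refine (norm_inner_le_norm _ _).trans ?_
  rw [hT, mul_one]
  have h4 : T.comp 1 (star (repOp ρ g)) - T.comp (star (repOp σ h)) 1 =
      HilbertSchmidt.comp (star (repOp σ h))
        (-(T.comp 1 (repOp ρ g) - T.comp (repOp σ h) 1)) (star (repOp ρ g)) := by
    refine HilbertSchmidt.ext_op fun v => ?_
    rw [neg_sub, HilbertSchmidt.comp_op, HilbertSchmidt.sub_op, HilbertSchmidt.sub_op, map_sub]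
    simp only [HilbertSchmidt.comp_op, one_apply_eq_self]
    rw [star_repOp, star_repOp, ← repOp_mul, ← repOp_mul, inv_mul_cancel, mul_inv_cancel,
      repOp_one, repOp_one]
    rfl
  rw [h4, star_repOp, star_repOp]
  exact (HilbertSchmidt.norm_comp_le_of_le_one (norm_repOp_le _ _) (norm_repOp_le _ _) _).trans
    (norm_neg _).le

end States

theorem hasApproxStates_of_hasApproxIntertwiners {X : Type*} [Groupoid X] [TopologicalSpace X]
    {x : X} {Γ : Subgroup (x ⟶ x)} {W : Γ → Set (Arrows X)}
    {L : Type*} [NormedAddCommGroup L] [InnerProductSpace ℂ L] [CompleteSpace L]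
    {ρ : Γ →* unitary (L →L[ℂ] L)} {Y : Set X} {K : Y → Type*} [∀ y, NormedAddCommGroup (K y)]
    [∀ y, InnerProductSpace ℂ (K y)] [∀ y, CompleteSpace (K y)]
    {σ : ∀ y : Y, ((y : X) ⟶ (y : X)) →* unitary (K y →L[ℂ] K y)}
    (h : HasApproxIntertwiners W ρ σ) : HasApproxStates W ρ σ := by
  classical
  -- The witnesses `(y, γ, T)` that are good for given `U`, `F` and `ε` form a filter base. The limit
  -- is taken along an ultrafilter containing it, so that `φ` depends on none of `U`, `F`, `ε`.
  let I : Type _ := Σ (y : Y) (z : X) (_ : z ⟶ (y : X)), {T : HilbertSchmidt L (K y) // ‖T‖ = 1}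
  let J : Type _ := {U : Set X // U ∈ 𝓝 x} × Finset Γ × {ε : ℝ // 0 < ε}
  let P : J → Set I := fun j => {i | i.2.1 ∈ j.1.1 ∧ ∀ g ∈ j.2.1,
    isotropySlice (W g) i.2.1 = ∅ ∨ ∃ h : i.2.1 ⟶ i.2.1, isotropySlice (W g) i.2.1 = {h} ∧
      ‖i.2.2.2.1.comp 1 (repOp ρ g) -
        i.2.2.2.1.comp (repOp (transportRep (σ i.1) i.2.2.1) h) 1‖ < j.2.2.1}
  have hP : ∀ j, (P j).Nonempty := by
    rintro ⟨⟨U, hU⟩, F, ε, hε⟩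
    obtain ⟨y, z, γ, T, hT, hz, hg⟩ := h U hU F ε hε
    exact ⟨⟨y, z, γ, T, hT⟩, hz, hg⟩
  have : Nonempty I := (hP ⟨⟨Set.univ, Filter.univ_mem⟩, ∅, 1, one_pos⟩).to_type
  have hne : (⨅ j, Filter.principal (P j)).NeBot := by
    refine Filter.iInf_neBot_of_directed ?_ fun j => Filter.principal_neBot_iff.2 (hP j)
    rintro ⟨⟨U, hU⟩, F, ε, hε⟩ ⟨⟨U', hU'⟩, F', ε', hε'⟩
    refine ⟨⟨⟨U ∩ U', Filter.inter_mem hU hU'⟩, F ∪ F', min ε ε', lt_min hε hε'⟩, ?_, ?_⟩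
    · refine Filter.principal_mono.2 ?_
      rintro i ⟨h1, h2⟩
      refine ⟨h1.1, fun g hg => (h2 g (Finset.mem_union_left _ hg)).imp_right ?_⟩
      exact fun ⟨h, h3, h4⟩ => ⟨h, h3, h4.trans_le (min_le_left _ _)⟩
    · refine Filter.principal_mono.2 ?_
      rintro i ⟨h1, h2⟩
      refine ⟨h1.2, fun g hg => (h2 g (Finset.mem_union_right _ hg)).imp_right ?_⟩
      exact fun ⟨h, h3, h4⟩ => ⟨h, h3, h4.trans_le (min_le_right _ _)⟩
  let l : Ultrafilter I := Ultrafilter.of (⨅ j, Filter.principal (P j))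
  have hl : ∀ j, ∀ᶠ i in l, i ∈ P j := fun j =>
    (Ultrafilter.of_le _).trans (iInf_le _ j) (Filter.mem_principal_self _)
  have hadj : ∀ i : I, ‖i.2.2.2.1.adjoint‖ = 1 := fun i =>
    (HilbertSchmidt.norm_adjoint _).trans i.2.2.2.2
  obtain ⟨ψ, hψ⟩ : ∃ ψ : I → RepState ρ, ∀ i, ψ i =
    RepState.ofHilbertSchmidt ρ i.2.2.2.1.adjoint (hadj i) := ⟨_, fun _ => rfl⟩
  obtain ⟨φ, hφ⟩ := RepState.exists_tendsto l ψ fun i a => by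
    rw [hψ]
    exact RepState.norm_ofHilbertSchmidt_le _ _ _ a
  refine ⟨φ, fun U hU F ε hε => ?_⟩
  have h0 : ∀ g : Γ, ∀ᶠ i in l, ‖φ.val g - (ψ i).val g‖ < ε / 2 := fun g => by
    filter_upwards [Metric.tendsto_nhds.1 (hφ (repAlgebra.of ρ g)) (ε / 2) (half_pos hε)] with i hi
    rw [dist_comm, dist_eq_norm] at hi
    exact hi
  have h1 : ∀ᶠ i in l, ∀ g ∈ F, ‖φ.val g - (ψ i).val g‖ < ε / 2 :=
    (Filter.eventually_all_finset F).2 fun g _ => h0 g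
  obtain ⟨⟨y, z, γ, T, hT⟩, h1, h2, h3⟩ :=
    (h1.and (hl ⟨⟨U, hU⟩, F, ε / 2, half_pos hε⟩)).exists
  refine ⟨y, z, γ, RepState.ofHilbertSchmidt (transportRep (σ y) γ) T hT, h2,
    fun g hg => (h3 g hg).imp_right ?_⟩
  rintro ⟨h, h4, h5⟩
  have hT' : ‖T.adjoint‖ = 1 := hadj ⟨y, z, γ, T, hT⟩
  have h6 : ‖φ.val g - (RepState.ofHilbertSchmidt ρ T.adjoint hT').val g‖ < ε / 2 := by
    have h8 := h1 g hg
    rwa [hψ] at h8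
  have h7 : ‖(RepState.ofHilbertSchmidt ρ T.adjoint hT').val g -
      (RepState.ofHilbertSchmidt (transportRep (σ y) γ) T hT).val h‖ < ε / 2 :=
    (RepState.norm_val_sub_val_le ρ (transportRep (σ y) γ) T hT hT' g h).trans_lt h5
  refine ⟨h, h4, ?_⟩
  have h8 := norm_sub_le_norm_sub_add_norm_sub (φ.val g)
    ((RepState.ofHilbertSchmidt ρ T.adjoint hT').val g)
    ((RepState.ofHilbertSchmidt (transportRep (σ y) γ) T hT).val h)
  linarith

/-! ### Almost invariant Hilbert–Schmidt operators -/

section Transfer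

variable {L : Type*} [NormedAddCommGroup L] [InnerProductSpace ℂ L] [CompleteSpace L]
  {V : Type*} [NormedAddCommGroup V] [InnerProductSpace ℂ V] [CompleteSpace V]
  {Γ : Type*} [Group Γ] {J : Type*}

/-- The vector `∑ a(p) R(p) v` for a finitely supported `a`. -/
def linComb (R : Γ → V →L[ℂ] V) (v : V) (a : Γ →₀ ℂ) : V := a.sum fun p c => c • R p v

/-- Nonzero vectors of an irreducible representation are cyclic. -/
theorem IsIrreducibleRep.dense_range_linComb {ρ : Γ →* unitary (L →L[ℂ] L)}
    (hirr : IsIrreducibleRep ρ) {v : L} (hv : v ≠ 0) :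
    Dense (Set.range (linComb (repOp ρ) v)) := by
  set M := Submodule.span ℂ (Set.range fun g => repOp ρ g v) with hM
  have hinv : ∀ g, ∀ w ∈ M.topologicalClosure, repOp ρ g w ∈ M.topologicalClosure := by
    intro g w hw
    have h1 : M ≤ M.comap (repOp ρ g).toLinearMap := by
      rw [hM, Submodule.span_le]
      rintro _ ⟨k, rfl⟩
      refine Submodule.subset_span ⟨g * k, ?_⟩
      exact repOp_mul ρ g k v
    exact map_mem_closure (repOp ρ g).continuous hw h1
  have hvM : v ∈ M.topologicalClosure :=
    M.le_topologicalClosure (Submodule.subset_span ⟨1, by simp [repOp_one]⟩)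
  have htop : M.topologicalClosure = ⊤ :=
    (hirr.2 _ M.isClosed_topologicalClosure hinv).resolve_left fun h => hv (by
      rwa [h, Submodule.mem_bot] at hvM)
  have hd : Dense (M : Set L) := Submodule.dense_iff_topologicalClosure_eq_top.2 htop
  refine hd.mono fun w hw => ?_
  obtain ⟨c, hc⟩ := Finsupp.mem_span_range_iff_exists_finsupp.1 hw
  exact ⟨c, hc⟩

/-- The functional `ψ ↦ ∑ conj (a(p)) b(q) ψ(k(p, q))` on functions on `J`. If `ψ(k(p, q))` is the
inner product of `R(p) v` and `A R(q) v`, its value at `ψ` is that of the linear combinations of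
these vectors with coefficients `a` and `b`. -/
def sesqui (k : Γ → Γ → J) (a b : Γ →₀ ℂ) : (J → ℂ) →L[ℂ] ℂ :=
  ∑ p ∈ a.support, ∑ q ∈ b.support,
    (starRingEnd ℂ (a p) * b q) • ContinuousLinearMap.proj (φ := fun _ : J => ℂ) (k p q)

theorem sesqui_apply {R : Γ → V →L[ℂ] V} {v : V} {A : V →L[ℂ] V} {k : Γ → Γ → J} {ψ : J → ℂ}
    (h : ∀ p q, inner ℂ (R p v) (A (R q v)) = ψ (k p q)) (a b : Γ →₀ ℂ) :
    sesqui k a b ψ = inner ℂ (linComb R v a) (A (linComb R v b)) := by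
  simp only [sesqui, linComb, Finsupp.sum, map_sum, sum_inner, inner_sum, map_smul,
    inner_smul_left, inner_smul_right, h, sum_apply,
    smul_apply, ContinuousLinearMap.proj_apply, smul_eq_mul]
  rw [Finset.sum_comm]
  refine Finset.sum_congr rfl fun q _ => ?_
  rw [Finset.mul_sum]
  exact Finset.sum_congr rfl fun p _ => by ring

/-- The functional whose value at the vector state of `v` is
`∑ (‖T‖² - ⟪T, R(g) T ρ(g)*⟫) - δ ‖T‖²`, where `T` maps the basis vector `eᵢ` to the linear
combination of the vectors `R(p) v` with coefficients `a i`, for `i ∈ E`. -/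
def defect (ρ : Γ →* unitary (L →L[ℂ] L)) (F : Finset Γ) (δ : ℝ) (j₀ : Γ → Γ → J)
    (j : Γ → Γ → Γ → J) (E : Finset (exists_hilbertBasis ℂ L).choose)
    (a : (exists_hilbertBasis ℂ L).choose → Γ →₀ ℂ) : (J → ℂ) →L[ℂ] ℂ :=
  ∑ g ∈ F, (∑ i ∈ E, sesqui j₀ (a i) (a i) - ∑ i ∈ E, ∑ k ∈ E,
      (inner ℂ (stdBasis L k) (star (repOp ρ g) (stdBasis L i)) : ℂ) •
        sesqui (fun p q => j p g q) (a i) (a k)) -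
    (δ : ℂ) • ∑ i ∈ E, sesqui j₀ (a i) (a i)

theorem re_defect (ρ : Γ →* unitary (L →L[ℂ] L)) (F : Finset Γ) (δ : ℝ) {j₀ : Γ → Γ → J}
    {j : Γ → Γ → Γ → J} {R : Γ → V →L[ℂ] V} {v : V} {ψ : J → ℂ}
    (h₀ : ∀ p q, inner ℂ (R p v) (R q v) = ψ (j₀ p q))
    (h : ∀ p g q, inner ℂ (R p v) (R g (R q v)) = ψ (j p g q))
    (E : Finset (exists_hilbertBasis ℂ L).choose)
    (a : (exists_hilbertBasis ℂ L).choose → Γ →₀ ℂ) {T : HilbertSchmidt L V}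
    (hT : T = HilbertSchmidt.finiteRank E fun i => linComb R v (a i)) :
    (defect ρ F δ j₀ j E a ψ).re =
      ∑ g ∈ F, (‖T‖ ^ 2 - (inner ℂ T (T.comp (R g) (star (repOp ρ g)))).re) - δ * ‖T‖ ^ 2 := by
  have h1 : ∑ i ∈ E, sesqui j₀ (a i) (a i) ψ = ((‖T‖ ^ 2 : ℝ) : ℂ) := by
    have h2 := inner_self_eq_norm_sq_to_K (𝕜 := ℂ) T
    push_cast
    refine Eq.trans ?_ h2
    rw [hT, HilbertSchmidt.inner_finiteRank_self]
    exact Finset.sum_congr rfl fun i _ => sesqui_apply (A := 1) h₀ _ _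
  have h3 : ∀ g, ∑ i ∈ E, ∑ k ∈ E,
      inner ℂ (stdBasis L k) (star (repOp ρ g) (stdBasis L i)) *
        sesqui (fun p q => j p g q) (a i) (a k) ψ =
      inner ℂ T (T.comp (R g) (star (repOp ρ g))) := by
    intro g
    rw [hT, HilbertSchmidt.inner_finiteRank_comp]
    refine Finset.sum_congr rfl fun i _ => Finset.sum_congr rfl fun k _ => ?_
    rw [sesqui_apply (A := R g) (R := R) (v := v) fun p q => h p g q]
  simp only [defect, sub_apply, sum_apply,
    smul_apply, smul_eq_mul, h1, h3, Complex.sub_re, Complex.re_sum,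
    Complex.re_ofReal_mul, Complex.ofReal_re]

/-- An amenable representation has Hilbert–Schmidt operators of norm one that are almost invariant
under conjugation. -/
theorem IsAmenableRep.exists_almost_invariant {ρ : Γ →* unitary (L →L[ℂ] L)}
    (hamen : IsAmenableRep ρ) (F : Finset Γ) {δ : ℝ} (hδ : 0 < δ) :
    ∃ S : HilbertSchmidt L L, ‖S‖ = 1 ∧
      ∑ g ∈ F, (‖S‖ ^ 2 - (inner ℂ S (S.comp (repOp ρ g) (star (repOp ρ g)))).re) < δ := by
  let l : (Γ → ℂ) →L[ℂ] ℂ := ∑ g ∈ F, ContinuousLinearMap.proj (φ := fun _ : Γ => ℂ) g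
  have hl : ∀ ψ : Γ → ℂ, l ψ = ∑ g ∈ F, ψ g := fun ψ => by simp [l]
  obtain ⟨S, hS, h⟩ := hamen.2.exists_re_lt (ξ := 1) (by simp) (-l) (c := δ - F.card) (by
    simp [hl, hδ])
  refine ⟨S, hS, ?_⟩
  have h2 : (∑ g ∈ F, inner ℂ S (S.comp (repOp ρ g) (star (repOp ρ g)))).re > F.card - δ := by
    rw [neg_apply, hl, Complex.neg_re] at h
    have h3 : (∑ g ∈ F, inner ℂ S (conjTensor ρ ρ g S)).re =
      (∑ g ∈ F, inner ℂ S (S.comp (repOp ρ g) (star (repOp ρ g)))).re := rfl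
    linarith
  rw [Complex.re_sum] at h2
  rw [Finset.sum_sub_distrib, hS]
  simp only [one_pow, Finset.sum_const, nsmul_eq_mul, mul_one]
  linarith

/-- Let `ρ` be irreducible and amenable, and let `R(g)` be contractions on `V` such that the vector
states of `ρ` are approximated by those on `V`, where `g ↦ R(g)` replaces `g ↦ ρ(g)` in products of
the form `R(p)* R(q)` and `R(p)* R(g) R(q)`. Then there are Hilbert–Schmidt operators into `V` that
almost intertwine `ρ(g)` and `R(g)`. -/
theorem exists_almost_intertwiner {ρ : Γ →* unitary (L →L[ℂ] L)} (hirr : IsIrreducibleRep ρ)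
    (hamen : IsAmenableRep ρ) {R : Γ → V →L[ℂ] V} (hR : ∀ g, ‖R g‖ ≤ 1)
    {A : J → L →L[ℂ] L} {B : J → V →L[ℂ] V} (hAB : WeaklyContained A B)
    (j₀ : Γ → Γ → J) (j : Γ → Γ → Γ → J)
    (hA₀ : ∀ p q v, inner ℂ (repOp ρ p v) (repOp ρ q v) = inner ℂ v (A (j₀ p q) v))
    (hA : ∀ p g q v, inner ℂ (repOp ρ p v) (repOp ρ g (repOp ρ q v)) = inner ℂ v (A (j p g q) v))
    (hB₀ : ∀ p q v, inner ℂ (R p v) (R q v) = inner ℂ v (B (j₀ p q) v))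
    (hB : ∀ p g q v, inner ℂ (R p v) (R g (R q v)) = inner ℂ v (B (j p g q) v))
    (F : Finset Γ) {δ : ℝ} (hδ : 0 < δ) :
    ∃ T : HilbertSchmidt L V,
      ∑ g ∈ F, ‖T - T.comp (R g) (star (repOp ρ g))‖ ^ 2 < δ * ‖T‖ ^ 2 := by
  obtain ⟨S, hS, hSF⟩ := hamen.exists_almost_invariant F (half_pos hδ)
  have := hirr.1
  obtain ⟨v, hv⟩ : ∃ v : L, ‖v‖ = 1 := by
    obtain ⟨w, hw⟩ := exists_ne (0 : L)
    exact ⟨_, norm_smul_inv_norm (𝕜 := ℂ) hw⟩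
  have hv0 : v ≠ 0 := fun h => by simp [h] at hv
  -- the strict inequality satisfied by `S` is an open condition, so it holds for some operator of
  -- finite rank with values in the span of the orbit of `v`
  let D : HilbertSchmidt L L → ℝ := fun S =>
    ∑ g ∈ F, (‖S‖ ^ 2 - (inner ℂ S (S.comp (repOp ρ g) (star (repOp ρ g)))).re) - δ / 2 * ‖S‖ ^ 2
  have hD : Continuous D := by
    have h1 : ∀ g, Continuous fun S : HilbertSchmidt L L =>
        S.comp (repOp ρ g) (star (repOp ρ g)) := fun g =>
      (HilbertSchmidt.compCLM (repOp ρ g) (star (repOp ρ g))).continuous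
    refine (continuous_finsetSum _ fun g _ => ?_).sub (by fun_prop)
    exact (continuous_norm.pow 2).sub (Complex.continuous_re.comp (continuous_id.inner (h1 g)))
  have hDS : D S < 0 := by
    change _ - δ / 2 * ‖S‖ ^ 2 < 0
    rw [hS] at hSF ⊢
    linarith
  obtain ⟨ε, hε, hball⟩ := Metric.isOpen_iff.1 (isOpen_lt hD continuous_const) S hDS
  obtain ⟨E, u, hu, huS⟩ :=
    S.exists_finiteRank_dist_lt (hirr.dense_range_linComb hv0) hε
  choose a ha using hu
  have hau : u = fun i => linComb (repOp ρ) v (a i) := funext fun i => (ha i).symm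
  have h1 : D (HilbertSchmidt.finiteRank E u) < 0 := hball (by
    rwa [Metric.mem_ball, dist_comm, dist_eq_norm])
  obtain ⟨η, -, h2⟩ := hAB.exists_re_lt hv (defect ρ F (δ / 2) j₀ j E a) (c := 0) (by
    rw [re_defect (R := repOp ρ) (v := v) (j₀ := j₀) (j := j)
      (ψ := fun k => inner ℂ v (A k v)) ρ F (δ / 2) (fun p q => hA₀ p q v)
      (fun p g q => hA p g q v) E a (T := HilbertSchmidt.finiteRank E u) (by rw [hau])]
    exact h1)
  set T : HilbertSchmidt L V := HilbertSchmidt.finiteRank E fun i => linComb R η (a i) with hT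
  rw [re_defect (R := R) (v := η) (j₀ := j₀) (j := j) (ψ := fun k => inner ℂ η (B k η)) ρ F (δ / 2) (fun p q => hB₀ p q η)
    (fun p g q => hB p g q η) E a hT] at h2
  refine ⟨T, ?_⟩
  -- as `R g` is a contraction, no lower bound of `‖R(g) T ρ(g)*‖` is needed
  have h3 : ∀ g, ‖T - T.comp (R g) (star (repOp ρ g))‖ ^ 2 ≤
      2 * (‖T‖ ^ 2 - (inner ℂ T (T.comp (R g) (star (repOp ρ g)))).re) := by
    intro g
    have h4 : ‖T.comp (R g) (star (repOp ρ g))‖ ≤ ‖T‖ :=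
      HilbertSchmidt.norm_comp_le_of_le_one (hR g) (by rw [star_repOp]; exact norm_repOp_le _ _) T
    have h5 := norm_sub_sq (𝕜 := ℂ) T (T.comp (R g) (star (repOp ρ g)))
    rw [h5]
    have h6 := pow_le_pow_left₀ (norm_nonneg _) h4 2
    change _ - 2 * (inner ℂ T (T.comp (R g) (star (repOp ρ g)))).re + _ ≤ _
    linarith
  have h7 := Finset.sum_le_sum fun g (_ : g ∈ F) => h3 g
  rw [← Finset.mul_sum] at h7
  linarith

end Transfer

/-! ### Direct sums of induced representations -/

section DirectSum

variable {X : Type*} [Groupoid X] [TopologicalSpace X] [TopologicalSpace (Arrows X)]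
  [EtaleGroupoid X] {Y : Set X} {K : Y → Type*} [∀ y, NormedAddCommGroup (K y)]
  [∀ y, InnerProductSpace ℂ (K y)] [∀ y, CompleteSpace (K y)]

/-- The direct sum of the induced representations `Ind π_y`. -/
def indSum (σ : ∀ y : Y, ((y : X) ⟶ (y : X)) →* unitary (K y →L[ℂ] K y)) (f : C_c(Arrows X, ℂ)) :
    lp (fun y : Y => IndSpace (σ y)) 2 →L[ℂ] lp (fun y : Y => IndSpace (σ y)) 2 :=
  directSum (fun y : Y => indRep (σ y)) indBound (fun f y => indRep_norm_le (σ y) f) f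

variable {σ : ∀ y : Y, ((y : X) ⟶ (y : X)) →* unitary (K y →L[ℂ] K y)}

theorem indSum_apply (f : C_c(Arrows X, ℂ)) (η : lp (fun y : Y => IndSpace (σ y)) 2) (y : Y) :
    indSum σ f η y = indRep (σ y) f (η y) := rfl

theorem indSum_convolution {W : Set (Arrows X)} (hW : IsOpenBisection W)
    {f f' F : C_c(Arrows X, ℂ)} (hf : tsupport f ⊆ W)
    (hF : ∀ {z w u : X} (h : z ⟶ w) (k : w ⟶ u), (⟨z, w, h⟩ : Arrows X) ∈ W →
        F ⟨z, u, h ≫ k⟩ = f ⟨z, w, h⟩ * f' ⟨w, u, k⟩)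
    (hF0 : ∀ g : Arrows X, g.r ∉ Arrows.r '' W → F g = 0)
    (η : lp (fun y : Y => IndSpace (σ y)) 2) :
    indSum σ F η = indSum σ f (indSum σ f' η) :=
  lp.ext (funext fun y => indRep_convolution hW hf hF hF0 (η y))

theorem indSum_norm_le_one {W : Set (Arrows X)} (hW : IsOpenBisection W)
    {f : C_c(Arrows X, ℂ)} (hf : tsupport f ⊆ W) (hf1 : ∀ a, ‖f a‖ ≤ 1) :
    ‖indSum σ f‖ ≤ 1 := by
  refine ContinuousLinearMap.opNorm_le_bound _ zero_le_one fun η => ?_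
  have h : ‖indSum σ f η‖ₑ ^ 2 ≤ ‖η‖ₑ ^ 2 := by
    rw [lp_two_enorm_sq, lp_two_enorm_sq]
    refine ENNReal.tsum_le_tsum fun y => ?_
    gcongr
    rw [indSum_apply]
    have h1 := indRep_norm_le_of_le_one hW hf hf1 (η y)
    simp only [enorm]
    exact_mod_cast h1
  have h2 := (ENNReal.pow_le_pow_left_iff (by norm_num)).1 h
  simp only [enorm] at h2
  rw [one_mul]
  exact_mod_cast h2

theorem inner_indSum_left {W : Set (Arrows X)} (hW : IsOpenBisection W)
    {f : C_c(Arrows X, ℂ)} (hf : tsupport f ⊆ W) (ξ η : lp (fun y : Y => IndSpace (σ y)) 2) :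
    inner ℂ (indSum σ f ξ) η = inner ℂ ξ (indSum σ (starFn f) η) := by
  rw [lp.inner_eq_tsum, lp.inner_eq_tsum]
  refine tsum_congr fun y => ?_
  rw [indSum_apply, indSum_apply, ← inner_conj_symm, ← inner_indRep_left hW hf, inner_conj_symm]

/-- The coordinates of a vector: the values at the representatives of all cosets. -/
def indSumCoord (σ : ∀ y : Y, ((y : X) ⟶ (y : X)) →* unitary (K y →L[ℂ] K y))
    (i : Σ y : Y, Cosets (y : X)) : lp (fun y : Y => IndSpace (σ y)) 2 →L[ℂ] K i.1 :=
  (IndSpace.eval (σ i.1) i.2.rep).comp (lp.evalCLM ℂ (fun y : Y => IndSpace (σ y)) 2 i.1)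

theorem indSumCoord_apply (i : Σ y : Y, Cosets (y : X))
    (η : lp (fun y : Y => IndSpace (σ y)) 2) : indSumCoord σ i η = (η i.1).fn i.2.rep := rfl

theorem enorm_sq_eq_tsum_indSumCoord (η : lp (fun y : Y => IndSpace (σ y)) 2) :
    ‖η‖ₑ ^ 2 = ∑' i, ‖indSumCoord σ i η‖ₑ ^ 2 := by
  rw [lp_two_enorm_sq, ENNReal.tsum_sigma']
  simp_rw [IndSpace.enorm_sq, indSumCoord_apply]

/-- At a coset of arrows with range `z`, a function supported in a bisection acts through its value
at an element `h` of the isotropy group at `z`, if the bisection contains one. -/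
theorem indSumCoord_indSum_of_mem {W : Set (Arrows X)} (hW : IsOpenBisection W)
    {f : C_c(Arrows X, ℂ)} (hf : tsupport f ⊆ W) (i : Σ y : Y, Cosets (y : X))
    {h : i.2.rep.1 ⟶ i.2.rep.1} (hh : h ∈ isotropySlice W i.2.rep.1)
    (η : lp (fun y : Y => IndSpace (σ y)) 2) :
    indSumCoord σ i (indSum σ f η) = f ⟨_, _, h⟩ •
      repOp (transportRep (σ i.1) i.2.rep.2) h (indSumCoord σ i η) := by
  rw [indSumCoord_apply, indSumCoord_apply, indSum_apply, indRep_fn]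
  refine (convFn_of_mem hW hf _ h hh i.2.rep.2).trans ?_
  congr 1
  set γ := i.2.rep.2
  have h1 : Groupoid.inv h ≫ γ = γ ≫ (Groupoid.inv γ ≫ Groupoid.inv h ≫ γ) := by simp
  rw [h1, IndSpace.fn_comp]
  congr 2
  change Groupoid.inv (Groupoid.inv γ ≫ Groupoid.inv h ≫ γ) = Groupoid.inv γ ≫ h ≫ γ
  simp

theorem indSumCoord_indSum_of_notMem {W : Set (Arrows X)}
    {f : C_c(Arrows X, ℂ)} (hf : tsupport f ⊆ W) (i : Σ y : Y, Cosets (y : X))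
    (hi : i.2.rep.1 ∉ Arrows.r '' W) (η : lp (fun y : Y => IndSpace (σ y)) 2) :
    indSumCoord σ i (indSum σ f η) = 0 := by
  rw [indSumCoord_apply, indSum_apply, indRep_fn]
  exact convFn_of_notMem hf _ hi _

end DirectSum

/-! ### Almost intertwining operators from weak containment -/

section Main

variable {X : Type*} [Groupoid X] [TopologicalSpace X] [TopologicalSpace (Arrows X)]
  [EtaleGroupoid X] {Y : Set X} {K : Y → Type*} [∀ y, NormedAddCommGroup (K y)]
  [∀ y, InnerProductSpace ℂ (K y)] [∀ y, CompleteSpace (K y)]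
  {σ : ∀ y : Y, ((y : X) ⟶ (y : X)) →* unitary (K y →L[ℂ] K y)}
  {x : X} {Γ : Subgroup (x ⟶ x)}
  {H : Type*} [NormedAddCommGroup H] [InnerProductSpace ℂ H] [CompleteSpace H]
  {π : (x ⟶ x) →* unitary (H →L[ℂ] H)}
  {L : Type*} [NormedAddCommGroup L] [InnerProductSpace ℂ L] [CompleteSpace L]
  {ρ : Γ →* unitary (L →L[ℂ] L)}

/-- Pairs of a function `f` on the groupoid and an element `k` of `Γ` such that `(Ind π)(f)`
compresses to `π(k)` on the vectors supported on the isotropy group. -/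
abbrev CompressionPair (Γ : Subgroup (x ⟶ x)) (π : (x ⟶ x) →* unitary (H →L[ℂ] H)) : Type _ :=
  {j : C_c(Arrows X, ℂ) × Γ // ∀ w : H,
    inner ℂ (IndSpace.delta π w) (indRep π j.1 (IndSpace.delta π w)) =
      inner ℂ w (repOp π (j.2 : x ⟶ x) w)}

/-- Weak containment is transported from the groupoid to `Γ` along compressions. -/
theorem weaklyContained_compression (hρπ : WeaklyContained (repOp ρ) (repOp (π.comp Γ.subtype)))
    (h : WeaklyContained (indRep π) (indSum σ)) :
    WeaklyContained (fun j : CompressionPair Γ π => repOp ρ j.1.2) (fun j => indSum σ j.1.1) := by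
  refine (hρπ.precomp fun j : CompressionPair Γ π => j.1.2).trans <| WeaklyContained.trans
    (weaklyContained_of_forall_exists fun w hw => ⟨IndSpace.delta π w, ?_, fun j => ?_⟩)
    (h.precomp fun j : CompressionPair Γ π => j.1.1)
  · rw [IndSpace.norm_delta, hw]
  · exact (j.2 w).symm

/-- Given functions `b g`, supported in bisections, that are one at `g` and bounded by one, there
are Hilbert–Schmidt operators into the space of `⨁ Ind π_y` that almost intertwine `ρ(g)` and the
operator of `b g`. -/
theorem exists_almost_intertwiner_indSum [T2Space (Arrows X)]
    (hirr : IsIrreducibleRep ρ) (hamen : IsAmenableRep ρ)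
    (hρπ : WeaklyContained (repOp ρ) (repOp (π.comp Γ.subtype)))
    (h : WeaklyContained (indRep π) (indSum σ))
    {W : Γ → Set (Arrows X)} (hW : ∀ g, IsOpenBisection (W g))
    {b : Γ → C_c(Arrows X, ℂ)} (hbW : ∀ g, tsupport (b g) ⊆ W g)
    (hb1 : ∀ g : Γ, b g ⟨x, x, (g : x ⟶ x)⟩ = 1) (hb : ∀ g a, ‖b g a‖ ≤ 1)
    (F : Finset Γ) {δ : ℝ} (hδ : 0 < δ) :
    ∃ T : HilbertSchmidt L (lp (fun y : Y => IndSpace (σ y)) 2),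
      ∑ g ∈ F, ‖T - T.comp (indSum σ (b g)) (star (repOp ρ g))‖ ^ 2 < δ * ‖T‖ ^ 2 := by
  have hW' : ∀ g, IsOpenBisection (arrowsInv ⁻¹' W g) := fun g => (hW g).preimage_inv
  have hbW' : ∀ g, tsupport (starFn (b g)) ⊆ arrowsInv ⁻¹' W g := fun g =>
    tsupport_starFn_subset (hbW g)
  have hb1' : ∀ g : Γ, starFn (b g) ⟨x, x, (g : x ⟶ x)⁻¹⟩ = 1 := fun g => by
    have : (arrowsInv ⟨x, x, (g : x ⟶ x)⁻¹⟩ : Arrows X) = ⟨x, x, (g : x ⟶ x)⟩ := by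
      change (⟨x, x, ((g : x ⟶ x)⁻¹)⁻¹⟩ : Arrows X) = _
      rw [inv_inv]
    rw [starFn_apply, this, hb1, map_one]
  -- the convolution products `b(p)* b(q)`, `b(g) b(q)` and `b(p)* b(g) b(q)`
  choose f₀ hf₀ hf₀' using fun p q => exists_convolution (hW' p) (hbW' p) (b q)
  choose f₁ hf₁ hf₁' using fun g q => exists_convolution (hW g) (hbW g) (b q)
  choose f₂ hf₂ hf₂' using fun p g q => exists_convolution (hW' p) (hbW' p) (f₁ g q)
  have hd : ∀ (g : Γ) (w : H), indRep π (b g) (IndSpace.delta π w) =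
      IndSpace.delta π (repOp π (g : x ⟶ x) w) := fun g w => indRep_delta (hW g) (hbW g) (hb1 g) w
  have hd' : ∀ (g : Γ) (w : H), indRep π (starFn (b g)) (IndSpace.delta π w) =
      IndSpace.delta π (repOp π (g : x ⟶ x)⁻¹ w) := fun g w =>
    indRep_delta (hW' g) (hbW' g) (hb1' g) w
  have hdd : ∀ v w : H, inner ℂ (IndSpace.delta π v) (IndSpace.delta π w) = inner ℂ v w := by
    intro v w
    rw [IndSpace.inner_delta, IndSpace.delta_fn]
    change inner ℂ v (repOp π (1 : x ⟶ x)⁻¹ w) = _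
    rw [inv_one, repOp_one]
    rfl
  let j₀ : Γ → Γ → CompressionPair Γ π := fun p q => ⟨(f₀ p q, p⁻¹ * q), fun w => by
    dsimp only
    rw [indRep_convolution (hW' p) (hbW' p) (hf₀ p q) (hf₀' p q), hd, hd', hdd, ← repOp_mul]
    rfl⟩
  let j : Γ → Γ → Γ → CompressionPair Γ π := fun p g q => ⟨(f₂ p g q, p⁻¹ * g * q), fun w => by
    dsimp only
    rw [indRep_convolution (hW' p) (hbW' p) (hf₂ p g q) (hf₂' p g q),
      indRep_convolution (hW g) (hbW g) (hf₁ g q) (hf₁' g q), hd, hd, hd', hdd, ← repOp_mul,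
      ← repOp_mul]
    rfl⟩
  refine exists_almost_intertwiner hirr hamen
    (fun g => indSum_norm_le_one (hW g) (hbW g) (hb g)) (weaklyContained_compression hρπ h) j₀ j
    (fun p q v => ?_) (fun p g q v => ?_) (fun p q v => ?_) (fun p g q v => ?_) F hδ
  · rw [inner_repOp_left, ← repOp_mul]
  · rw [inner_repOp_left, ← repOp_mul, ← repOp_mul]
  · change _ = inner ℂ v (indSum σ (f₀ p q) v)
    rw [indSum_convolution (hW' p) (hbW' p) (hf₀ p q) (hf₀' p q), inner_indSum_left (hW p) (hbW p)]
  · change _ = inner ℂ v (indSum σ (f₂ p g q) v)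
    rw [indSum_convolution (hW' p) (hbW' p) (hf₂ p g q) (hf₂' p g q),
      indSum_convolution (hW g) (hbW g) (hf₁ g q) (hf₁' g q), inner_indSum_left (hW p) (hbW p)]

theorem hasApproxIntertwiners_of_weaklyContained [T2Space (Arrows X)]
    [LocallyCompactSpace (Arrows X)]
    (W : Γ → Set (Arrows X)) (hW : ∀ g, IsOpenBisection (W g))
    (hgW : ∀ g : Γ, (⟨x, x, (g : x ⟶ x)⟩ : Arrows X) ∈ W g)
    (hirr : IsIrreducibleRep ρ) (hamen : IsAmenableRep ρ)
    (hρπ : WeaklyContained (repOp ρ) (repOp (π.comp Γ.subtype)))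
    (h : WeaklyContained (indRep π) (indSum σ)) : HasApproxIntertwiners W ρ σ := by
  classical
  intro U hU F ε hε
  -- cut down the bisections to arrows with range in `U`
  let W' : Γ → Set (Arrows X) := fun g => W g ∩ Arrows.r ⁻¹' interior U
  have hW' : ∀ g, IsOpenBisection (W' g) := fun g =>
    (hW g).inter (isOpen_interior.preimage continuous_arrows_r)
  have hgW' : ∀ g : Γ, (⟨x, x, (g : x ⟶ x)⟩ : Arrows X) ∈ W' g := fun g =>
    ⟨hgW g, mem_interior_iff_mem_nhds.2 hU⟩
  choose b hbW hb1 hb using fun g => exists_bump (hW' g).1 (hgW' g)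
  have hbn : ∀ g a, ‖b g a‖ ≤ 1 := fun g a => by
    obtain ⟨t, ht, hbt⟩ := hb g a
    rw [hbt, Complex.norm_real, Real.norm_eq_abs, abs_of_nonneg ht.1]
    exact ht.2
  obtain ⟨κ, hκ0, hκε, hκ1⟩ : ∃ κ : ℝ, 0 < κ ∧ 2 * κ ≤ ε ∧ κ < 1 :=
    ⟨min (ε / 2) (1 / 2), by positivity, by linarith [min_le_left (ε / 2) (1 / 2)],
      (min_le_right _ _).trans_lt (by norm_num)⟩
  -- the unit of `Γ` is included in order to have the range of the arrow in `U`
  obtain ⟨T, hT⟩ := exists_almost_intertwiner_indSum (σ := σ) hirr hamen hρπ h hW' hbW hb1 hbn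
    (insert 1 F) (pow_pos hκ0 2)
  obtain ⟨i, hi⟩ := HilbertSchmidt.exists_postcomp_lt (indSumCoord σ) enorm_sq_eq_tsum_indSumCoord
    (insert 1 F) _ T hT
  set S : HilbertSchmidt L (K i.1) := T.postcomp (indSumCoord σ i) with hS
  have hlt : ∀ g ∈ insert 1 F, ‖(T - T.comp (indSum σ (b g)) (star (repOp ρ g))).postcomp
      (indSumCoord σ i)‖ < κ * ‖S‖ := by
    intro g hg
    refine lt_of_pow_lt_pow_left₀ 2 (by positivity) ?_
    rw [mul_pow]
    refine lt_of_le_of_lt ?_ hi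
    exact Finset.single_le_sum (f := fun g => ‖(T - T.comp (indSum σ (b g))
      (star (repOp ρ g))).postcomp (indSumCoord σ i)‖ ^ 2) (fun g _ => by positivity) hg
  have hSpos : 0 < ‖S‖ := by
    have := (norm_nonneg _).trans_lt (hlt 1 (Finset.mem_insert_self _ _))
    exact pos_of_mul_pos_right this hκ0.le
  have hzU : i.2.rep.1 ∈ U := by
    by_contra hz
    have h1 := hlt 1 (Finset.mem_insert_self _ _)
    have h2 : (T - T.comp (indSum σ (b 1)) (star (repOp ρ 1))).postcomp (indSumCoord σ i) = S := by
      refine HilbertSchmidt.ext_op fun v => ?_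
      rw [HilbertSchmidt.postcomp_op, HilbertSchmidt.sub_op, HilbertSchmidt.comp_op, map_sub,
        indSumCoord_indSum_of_notMem (hbW 1), sub_zero]
      · rfl
      · rintro ⟨a, ha, har⟩
        refine hz (interior_subset ?_)
        rw [← har]
        exact ha.2
    rw [h2] at h1
    nlinarith
  have hinv : ((‖S‖⁻¹ : ℝ) : ℂ) ≠ 0 := by exact_mod_cast (inv_pos.2 hSpos).ne'
  refine ⟨i.1, i.2.rep.1, i.2.rep.2, ((‖S‖⁻¹ : ℝ) : ℂ) • S, ?_, hzU, fun g hg => ?_⟩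
  · rw [norm_smul, Complex.norm_real, norm_inv, norm_norm, inv_mul_cancel₀ hSpos.ne']
  refine (isotropySlice (W g) i.2.rep.1).eq_empty_or_nonempty.imp_right ?_
  rintro ⟨k, hk⟩
  refine ⟨k, Set.eq_singleton_iff_unique_mem.2 ⟨hk, fun k' hk' => ?_⟩, ?_⟩
  · have := (hW g).2.1 hk' hk rfl
    simpa using this
  set τ := repOp (transportRep (σ i.1) i.2.rep.2) k with hτ
  obtain ⟨t, ht, hbt⟩ := hb g ⟨_, _, k⟩
  set S' : HilbertSchmidt L (K i.1) := S.comp τ (star (repOp ρ g)) with hS'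
  have hn' : ‖S'‖ ≤ ‖S‖ := HilbertSchmidt.norm_comp_le_of_le_one (norm_repOp_le _ _)
    (by rw [star_repOp]; exact norm_repOp_le _ _) S
  have h1 := hlt g (Finset.mem_insert_of_mem hg)
  have h2 : (T - T.comp (indSum σ (b g)) (star (repOp ρ g))).postcomp (indSumCoord σ i) =
      S - (t : ℂ) • S' := by
    refine HilbertSchmidt.ext_op fun v => ?_
    rw [HilbertSchmidt.postcomp_op, HilbertSchmidt.sub_op, HilbertSchmidt.comp_op, map_sub]
    by_cases hz : i.2.rep.1 ∈ interior U
    · rw [indSumCoord_indSum_of_mem (hW' g) (hbW g) i ⟨hk, hz⟩, hbt]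
      rfl
    · have ht0 : (t : ℂ) = 0 := by
        rw [← hbt]
        by_contra h0
        exact hz (hbW g (subset_tsupport _ h0)).2
      rw [indSumCoord_indSum_of_notMem (hbW g), ht0, zero_smul, sub_zero, sub_zero]
      · rfl
      · rintro ⟨a, ha, har⟩
        refine hz ?_
        rw [← har]
        exact ha.2
  rw [h2] at h1
  -- as the two sides have nearly the same norm, `t` is close to one
  have h3 : (1 - t) * ‖S‖ < κ * ‖S‖ := by
    have h4 := norm_sub_norm_le S ((t : ℂ) • S')
    rw [norm_smul, Complex.norm_real, Real.norm_eq_abs, abs_of_nonneg ht.1] at h4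
    have h5 := mul_le_mul_of_nonneg_left hn' ht.1
    linarith
  have h4 : ‖S - S'‖ < 2 * κ * ‖S‖ := by
    have h5 : S - S' = (S - (t : ℂ) • S') - ((1 - t : ℝ) : ℂ) • S' := by
      push_cast
      rw [sub_smul, one_smul]
      abel
    have h6 : ‖((1 - t : ℝ) : ℂ) • S'‖ ≤ (1 - t) * ‖S‖ := by
      rw [norm_smul, Complex.norm_real, Real.norm_eq_abs, abs_of_nonneg (sub_nonneg.2 ht.2)]
      exact mul_le_mul_of_nonneg_left hn' (sub_nonneg.2 ht.2)
    have h7 := norm_sub_le (S - (t : ℂ) • S') (((1 - t : ℝ) : ℂ) • S')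
    rw [← h5] at h7
    linarith
  have h5 : (((‖S‖⁻¹ : ℝ) : ℂ) • S).comp 1 (repOp ρ g) - (((‖S‖⁻¹ : ℝ) : ℂ) • S).comp τ 1 =
      ((‖S‖⁻¹ : ℝ) : ℂ) • (S - S').comp 1 (repOp ρ g) := by
    refine HilbertSchmidt.ext_op fun v => ?_
    have h6 : star (repOp ρ g) (repOp ρ g v) = v := by
      rw [star_repOp, ← repOp_mul, inv_mul_cancel, repOp_one]
      rfl
    simp only [HilbertSchmidt.sub_op, HilbertSchmidt.smul_op, HilbertSchmidt.comp_op, hS',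
      one_apply_eq_self, map_smul, smul_sub, h6]
  rw [h5, norm_smul, Complex.norm_real, norm_inv, norm_norm]
  have h6 : ‖(S - S').comp 1 (repOp ρ g)‖ ≤ ‖S - S'‖ :=
    HilbertSchmidt.norm_comp_le_of_le_one ContinuousLinearMap.norm_id_le (norm_repOp_le _ _) _
  calc _ ≤ ‖S‖⁻¹ * ‖S - S'‖ := by gcongr
    _ < ‖S‖⁻¹ * (2 * κ * ‖S‖) := by gcongr
    _ = 2 * κ := by field_simp
    _ ≤ ε := hκε

end Main

end

theorem theorem2p1 {X : Type*} [Groupoid X] [TopologicalSpace X] [TopologicalSpace (Arrows X)]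
    [EtaleGroupoid X] [T2Space (Arrows X)] [LocallyCompactSpace (Arrows X)]
    (x : X) (Γ : Subgroup (x ⟶ x))
    (W : Γ → Set (Arrows X)) (hW : ∀ g, IsOpenBisection (W g))
    (hgW : ∀ g : Γ, (⟨x, x, (g : x ⟶ x)⟩ : Arrows X) ∈ W g)
    {H : Type*} [NormedAddCommGroup H] [InnerProductSpace ℂ H] [CompleteSpace H]
    (π : (x ⟶ x) →* unitary (H →L[ℂ] H))
    {L : Type*} [NormedAddCommGroup L] [InnerProductSpace ℂ L] [CompleteSpace L]
    (ρ : Γ →* unitary (L →L[ℂ] L)) (hirr : IsIrreducibleRep ρ) (hamen : IsAmenableRep ρ)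
    (hρπ : WeaklyContained (repOp ρ) (repOp (π.comp Γ.subtype)))
    (Y : Set X) {K : Y → Type*} [∀ y, NormedAddCommGroup (K y)]
    [∀ y, InnerProductSpace ℂ (K y)] [∀ y, CompleteSpace (K y)]
    (σ : ∀ y : Y, ((y : X) ⟶ (y : X)) →* unitary (K y →L[ℂ] K y)) :
    (WeaklyContained (indRep π)
        (directSum (fun y : Y => indRep (σ y)) indBound fun f y => indRep_norm_le (σ y) f) →
      HasApproxIntertwiners W ρ σ) ∧
    (HasApproxIntertwiners W ρ σ → HasApproxStates W ρ σ) := by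
  exact ⟨hasApproxIntertwiners_of_weaklyContained W hW hgW hirr hamen hρπ,
    hasApproxStates_of_hasApproxIntertwiners⟩
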